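/- All trees are finite. A rooted tree is a tree with a distinguished vertex $\rho$, the root, whose degree is not one, such that every vertex other than $\rho$ has degree one (a leaf) or at least three; leaves carry pairwise distinct labels and are identified with them. A triple $ab|c$ (with $a,b,c$ pairwise distinct, $ab|c=ba|c$) is the binary rooted tree with leaves $a,b,c$ in which the path from $a$ to $b$ does not intersect the path from $c$ to the root. A rooted tree $T$ displays $ab|c$ if $a,b,c$ are leaves of $T$ and the path in $T$ from $a$ to $b$ has no vertex in common with the path from $c$ to the root; $\mathcal R(T)$ denotes the set of triples displayed by $T$. A set $R$ of triples is consistent if $R\subseteq\mathcal R(T)$ for some rooted tree $T$. Let $L_R=\bigcup_{ab|c\in R}\{a,b,c\}$, let $\operatorname{span}(R)$ be the set of rooted trees with leaf set $L_R$ that display all triples of $R$, and let $\operatorname{cl}(R)=\bigcap_{T\in\operatorname{span}(R)}\mathcal R(T)$. Put $$\mathfrak{sc}(R)=\{R'\subseteq R : \operatorname{cl}(R')=\operatorname{cl}(R)\},$$ let $\min(\mathfrak{sc}(R))$ be the set of inclusion-minimal elements of $\mathfrak{sc}(R)$, and let $$\operatorname{MIN}(\mathfrak{sc}(R))=\{R'\in\mathfrak{sc}(R)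 : |R'|\le|R''| \text{ for all } R''\in\mathfrak{sc}(R)\}.$$ Finally let $\mathbb F_R=\{R'' : R''\subseteq R' \text{ for some } R'\in\min(\mathfrak{sc}(R))\}$. **Theorem.** Let $R$ be a consistent set of triples. Then $(R,\mathbb F_R)$ is a matroid (with ground set $R$ and independent sets $\mathbb F_R$) whose set of bases is $\min(\mathfrak{sc}(R))$, and $$\min(\mathfrak{sc}(R))=\operatorname{MIN}(\mathfrak{sc}(R)).$$ -/

import Mathlib

/-- A rooted triple `ab|c` on the label type `α`: an unordered pair `{a, b}` of distinct labels
together with a third label `c` different from both. Up to isomorphism this is the same thing as a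
binary rooted tree with the three leaves `a, b, c` in which the path from `a` to `b` avoids the path
from `c` to the root; `ab|c` and `ba|c` are the same triple. -/
@[ext]
structure Triple (α : Type*) where
  pair : Sym2 α
  out : α
  pair_not_isDiag : ¬ pair.IsDiag
  out_notMem_pair : out ∉ pair

/-- The set `{a, b, c}` of leaves of a triple `ab|c`. -/
def Triple.leaves {α : Type*} (t : Triple α) : Set α :=
  {x | x ∈ t.pair ∨ x = t.out}

/-- A finite rooted tree whose leaves (the vertices of degree one) carry pairwise distinct labels
from `α`. The root is an inner vertex (its degree is not one) and every other inner vertex has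
degree at least three. As the vertex set is finite, taking it in `Type` covers all trees up to
isomorphism. -/
structure PhyloTree (α : Type*) where
  V : Type
  finite_V : Finite V
  graph : SimpleGraph V
  isTree : graph.IsTree
  root : V
  root_inner : (graph.neighborSet root).ncard ≠ 1
  three_le_degree : ∀ v, v ≠ root → (graph.neighborSet v).ncard ≠ 1 →
    3 ≤ (graph.neighborSet v).ncard
  label : {v : V // (graph.neighborSet v).ncard = 1} ↪ α

namespace PhyloTree

variable {α : Type*}

/-- The leaf set of the tree, as a set of labels. -/
def leafSet (T : PhyloTree α) : Set α :=
  Set.range T.label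

/-- `a, b, c` are leaves of `T`, and the path from `a` to `b` does not intersect (in a vertex) the
path from `c` to the root. -/
def Separates (T : PhyloTree α) (a b c : α) : Prop :=
  ∃ x y z : {v : T.V // (T.graph.neighborSet v).ncard = 1},
    T.label x = a ∧ T.label y = b ∧ T.label z = c ∧
    ∃ (p : T.graph.Path x.1 y.1) (q : T.graph.Path z.1 T.root),
      ∀ v, v ∈ p.1.support → v ∉ q.1.support

/-- The set `𝓡(T)` of all triples displayed by `T`. -/
def triples (T : PhyloTree α) : Set (Triple α) :=
  {t | ∃ a b : α, t.pair = s(a, b) ∧ T.Separates a b t.out}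

end PhyloTree

namespace TripleSet

variable {α : Type*}

/-- The set `L_R` of all leaves of triples in `R`. -/
def leaves (R : Set (Triple α)) : Set α :=
  ⋃ t ∈ R, t.leaves

/-- `R` is consistent: some rooted tree displays all triples of `R`. -/
def Consistent (R : Set (Triple α)) : Prop :=
  ∃ T : PhyloTree α, R ⊆ T.triples

/-- The rooted trees with leaf set `L_R` that display `R`. -/
def span (R : Set (Triple α)) : Set (PhyloTree α) :=
  {T | T.leafSet = leaves R ∧ R ⊆ T.triples}

/-- The closure of `R`. -/
def cl (R : Set (Triple α)) : Set (Triple α) :=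
  ⋂ T ∈ span R, T.triples

/-- The representative subsets of `R`, i.e. those with the same closure as `R`. -/
def sc (R : Set (Triple α)) : Set (Set (Triple α)) :=
  {R' | R' ⊆ R ∧ cl R' = cl R}

/-- The inclusion-minimal representative subsets of `R`. -/
def minSc (R : Set (Triple α)) : Set (Set (Triple α)) :=
  {R' | R' ∈ sc R ∧ ∀ R'' ∈ sc R, R'' ⊆ R' → R'' = R'}

/-- The representative subsets of `R` of minimum cardinality. -/
def MINSc (R : Set (Triple α)) : Set (Set (Triple α)) :=
  {R' | R' ∈ sc R ∧ ∀ R'' ∈ sc R, R'.encard ≤ R''.encard}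

/-- The collection `𝔽_R` of all subsets of inclusion-minimal representative subsets of `R`. -/
def indepSets (R : Set (Triple α)) : Set (Set (Triple α)) :=
  {I | ∃ R' ∈ minSc R, I ⊆ R'}

end TripleSet

/-! The Aho graph `[R, L]` has vertex set `L` and an edge `ab` for each `ab|c ∈ R` with all leaves
in `L`. If `R` is consistent, no such graph with `L ⊆ leaves R` and `|L| ≥ 2` is connected;
conversely BUILD turns this condition into a tree (`AhoConsistent.span_nonempty`). Consequently
`ab|c ∈ cl R` exactly when some `[R, A ∪ C]` has the two components `A ∋ a, b` and `C ∋ c`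
(`AhoConsistent.mem_cl_iff`), and `S ⊆ R` is representative exactly when every triple of `R` crosses
such a split for `S`.

For `t ∈ R` the splits crossed by `t` are closed under union, so there is a largest one, with vertex
set `scope R t`. A triple of `R` with leaves inside this scope has the same scope or a strictly
smaller one (`AhoConsistent.scope_eq_or_ssubset`). By induction on the scope, `S` is representative
iff the following holds for every scope: once the pairs of all triples of `R` with smaller scope are
contracted, the pairs of the triples of `S` with this scope connect the pair of every triple of `R`
with this scope.

This says that `S` spans a direct sum of graphic matroids, one for each scope; `tieClosure R` is the
closure operator. Its exchange property is the graphic one, so the minimal representative sets are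
the bases of a matroid and have equal cardinality. -/

/-! ### Ancestors in a rooted tree -/

namespace SimpleGraph

variable {V : Type*} {G : SimpleGraph V} {ρ : V}

/-- The ancestors of `u` with respect to the root `ρ`: the vertices met by every walk from `u`
to `ρ`. -/
def ancestors (G : SimpleGraph V) (ρ u : V) : Set V :=
  {v | ∀ p : G.Walk u ρ, v ∈ p.support}

lemma ancestors_trans {u v w : V} (hv : v ∈ G.ancestors ρ u) (hw : w ∈ G.ancestors ρ v) :
    w ∈ G.ancestors ρ u := by
  classical
  intro p
  exact p.support_dropUntil_subset_support (hv p) (hw (p.dropUntil v (hv p)))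

lemma mem_ancestors_of_adj {u u' v : V} (h : G.Adj u u') (hv : v ∈ G.ancestors ρ u)
    (hne : v ≠ u) : v ∈ G.ancestors ρ u' := by
  intro p
  have := hv (Walk.cons h p)
  rw [Walk.support_cons, List.mem_cons] at this
  exact this.resolve_left hne

/-- The initial segment of `p` up to its first visit to either vertex avoids the other one. -/
lemma exists_walk_avoiding {u v w : V} (p : G.Walk u ρ) (hv : v ∈ p.support)
    (hw : w ∈ p.support) (hne : v ≠ w) :
    (∃ q : G.Walk u v, w ∉ q.support) ∨ ∃ q : G.Walk u w, v ∉ q.support := by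
  induction p with
  | nil => simp_all
  | @cons u u' _ h p ih =>
    by_cases huv : u = v
    · subst huv
      exact Or.inl ⟨Walk.nil, by simpa using hne.symm⟩
    by_cases huw : u = w
    · subst huw
      exact Or.inr ⟨Walk.nil, by simpa using hne⟩
    rw [Walk.support_cons, List.mem_cons] at hv hw
    rcases ih (hv.resolve_left (Ne.symm huv)) (hw.resolve_left (Ne.symm huw)) with ⟨q, hq⟩ | ⟨q, hq⟩
    · exact Or.inl ⟨Walk.cons h q, by simp [hq, Ne.symm huw]⟩
    · exact Or.inr ⟨Walk.cons h q, by simp [hq, Ne.symm huv]⟩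

/-- If a walk from `u` to `v` avoids `w`, then every continuation from `v` to the root has to meet
`w`. -/
lemma ancestors_chain (hG : G.Connected) {u v w : V} (hv : v ∈ G.ancestors ρ u)
    (hw : w ∈ G.ancestors ρ u) : v ∈ G.ancestors ρ w ∨ w ∈ G.ancestors ρ v := by
  have key : ∀ {a b : V}, b ∈ G.ancestors ρ u → ∀ q : G.Walk u a, b ∉ q.support →
      b ∈ G.ancestors ρ a := by
    intro a b hb q hq p
    have := hb (q.append p)
    rw [Walk.mem_support_append_iff] at this
    exact this.resolve_left hq
  by_cases hne : v = w
  · subst hne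
    exact Or.inl fun p => p.start_mem_support
  obtain ⟨p⟩ := hG.preconnected u ρ
  rcases exists_walk_avoiding p (hv p) (hw p) hne with ⟨q, hq⟩ | ⟨q, hq⟩
  · exact Or.inr (key hw q hq)
  · exact Or.inl (key hv q hq)

lemma IsTree.mem_ancestors_of_path (hG : G.IsTree) {u v : V} (q : G.Path u ρ)
    (hv : v ∈ q.1.support) : v ∈ G.ancestors ρ u := by
  classical
  intro p
  have : q = p.toPath := (hG.isAcyclic.subsingleton_path _ _).elim _ _
  rw [this] at hv
  exact p.support_bypass_subset_support hv

lemma IsTree.mem_ancestors_or_of_adj (hG : G.IsTree) {u v : V} (h : G.Adj u v) :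
    u ∈ G.ancestors ρ v ∨ v ∈ G.ancestors ρ u := by
  classical
  obtain ⟨p⟩ := hG.connected.preconnected v ρ
  by_cases hu : u ∈ p.toPath.1.support
  · exact Or.inl (hG.mem_ancestors_of_path _ hu)
  · exact Or.inr (hG.mem_ancestors_of_path ⟨Walk.cons h p.toPath.1, p.toPath.2.cons hu⟩ (by simp))

/-- The witness is a topmost vertex of the walk. Prepending an edge can change it only if it was the
old starting vertex and the new one is above it. -/
lemma IsTree.exists_common_ancestor (hG : G.IsTree) {x y : V} (p : G.Walk x y) :
    ∃ v ∈ p.support, v ∈ G.ancestors ρ x ∧ v ∈ G.ancestors ρ y := by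
  induction p with
  | nil => exact ⟨_, by simp, fun p => p.start_mem_support, fun p => p.start_mem_support⟩
  | @cons x x' y h p ih =>
    obtain ⟨v, hvp, hvx, hvy⟩ := ih
    by_cases hv : v = x'
    · subst hv
      rcases hG.mem_ancestors_or_of_adj (ρ := ρ) h with h' | h'
      · exact ⟨x, by simp, fun p => p.start_mem_support, ancestors_trans hvy h'⟩
      · exact ⟨v, by simp [hvp], h', hvy⟩
    · exact ⟨v, by simp [hvp], mem_ancestors_of_adj h.symm hvx hv, hvy⟩

lemma exists_walk_to_ancestor {x v : V} (p : G.Walk x ρ) (hv : v ∈ G.ancestors ρ x) :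
    ∃ q : G.Walk x v, ∀ u ∈ q.support, v ∈ G.ancestors ρ u := by
  induction p with
  | @nil u =>
    have : v = u := by simpa using hv Walk.nil
    subst this
    exact ⟨Walk.nil, fun u hu => by simp at hu; subst hu; exact hv⟩
  | @cons x x' _ h p ih =>
    by_cases hx : v = x
    · subst hx
      exact ⟨Walk.nil, fun u hu => by simp at hu; subst hu; exact hv⟩
    · obtain ⟨q, hq⟩ := ih (mem_ancestors_of_adj h hv hx)
      refine ⟨Walk.cons h q, fun u hu => ?_⟩
      rw [Walk.support_cons, List.mem_cons] at hu
      rcases hu with rfl | hu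
      exacts [hv, hq u hu]

end SimpleGraph

/-! ### Inference rules for displayed triples -/

namespace PhyloTree

variable {α : Type*} (T : PhyloTree α)

/-- The leaves labelled `a` and `b` have a common ancestor which is not an ancestor of the leaf
labelled `c`. -/
lemma separates_iff {a b c : α} : T.Separates a b c ↔
    ∃ x y z : {v : T.V // (T.graph.neighborSet v).ncard = 1},
      T.label x = a ∧ T.label y = b ∧ T.label z = c ∧
      ∃ v, v ∈ T.graph.ancestors T.root x.1 ∧ v ∈ T.graph.ancestors T.root y.1 ∧
        v ∉ T.graph.ancestors T.root z.1 := by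
  classical
  constructor
  · rintro ⟨x, y, z, hx, hy, hz, p, q, hpq⟩
    obtain ⟨v, hvp, hvx, hvy⟩ := T.isTree.exists_common_ancestor (ρ := T.root) p.1
    exact ⟨x, y, z, hx, hy, hz, v, hvx, hvy, fun h => hpq v hvp (h q.1)⟩
  · rintro ⟨x, y, z, hx, hy, hz, v, hvx, hvy, hvz⟩
    obtain ⟨q, hq⟩ : ∃ q : T.graph.Walk z.1 T.root, v ∉ q.support := by
      simpa [SimpleGraph.ancestors] using hvz
    obtain ⟨px⟩ := T.isTree.connected.preconnected x.1 T.root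
    obtain ⟨py⟩ := T.isTree.connected.preconnected y.1 T.root
    obtain ⟨p₁, hp₁⟩ := SimpleGraph.exists_walk_to_ancestor px hvx
    obtain ⟨p₂, hp₂⟩ := SimpleGraph.exists_walk_to_ancestor py hvy
    refine ⟨x, y, z, hx, hy, hz, (p₁.append p₂.reverse).toPath, q.toPath, fun u hu hu' => ?_⟩
    have hu := (p₁.append p₂.reverse).support_bypass_subset_support hu
    have hu' := q.support_bypass_subset_support hu'
    have hvu : v ∈ T.graph.ancestors T.root u := by
      rw [SimpleGraph.Walk.mem_support_append_iff, SimpleGraph.Walk.support_reverse,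
        List.mem_reverse] at hu
      rcases hu with hu | hu
      exacts [hp₁ u hu, hp₂ u hu]
    exact hq (q.support_dropUntil_subset_support hu' (hvu _))

variable {T}

lemma Separates.symm {a b c : α} (h : T.Separates a b c) : T.Separates b a c := by
  rw [separates_iff] at h ⊢
  obtain ⟨x, y, z, hx, hy, hz, v, h1, h2, h3⟩ := h
  exact ⟨y, x, z, hy, hx, hz, v, h2, h1, h3⟩

lemma Separates.mem_leafSet {a b c : α} (h : T.Separates a b c) :
    a ∈ T.leafSet ∧ b ∈ T.leafSet ∧ c ∈ T.leafSet := by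
  obtain ⟨x, y, z, rfl, rfl, rfl, -⟩ := h
  exact ⟨⟨x, rfl⟩, ⟨y, rfl⟩, ⟨z, rfl⟩⟩

/-- The two separating vertices are ancestors of the same leaf, hence comparable; the upper one is
an ancestor of all three leaves. -/
lemma Separates.asymm {a b c : α} (h : T.Separates a b c) : ¬ T.Separates a c b := by
  intro h'
  rw [separates_iff] at h h'
  obtain ⟨x, y, z, rfl, rfl, rfl, v, h1, h2, h3⟩ := h
  obtain ⟨x', z', y', hx, hz, hy, w, h1', h2', h3'⟩ := h'
  obtain rfl := T.label.injective hx
  obtain rfl := T.label.injective hy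
  obtain rfl := T.label.injective hz
  rcases SimpleGraph.ancestors_chain T.isTree.connected h1 h1' with h | h
  · exact h3 (SimpleGraph.ancestors_trans h2' h)
  · exact h3' (SimpleGraph.ancestors_trans h2 h)

lemma Separates.or_of_mem_leafSet {a b c d : α} (h : T.Separates a b c) (hd : d ∈ T.leafSet) :
    T.Separates a d c ∨ T.Separates a b d := by
  simp only [separates_iff] at h ⊢
  obtain ⟨x, y, z, hx, hy, hz, v, h1, h2, h3⟩ := h
  obtain ⟨w, hw⟩ := hd
  by_cases hvw : v ∈ T.graph.ancestors T.root w.1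
  · exact Or.inl ⟨x, w, z, hx, hw, hz, v, h1, hvw, h3⟩
  · exact Or.inr ⟨x, y, w, hx, hy, hw, v, h1, h2, hvw⟩

lemma mem_triples_iff {t : Triple α} {a b : α} (h : t.pair = s(a, b)) :
    t ∈ T.triples ↔ T.Separates a b t.out := by
  constructor
  · rintro ⟨a', b', h', hs⟩
    rw [h, Sym2.eq_iff] at h'
    rcases h' with ⟨rfl, rfl⟩ | ⟨rfl, rfl⟩
    exacts [hs, hs.symm]
  · exact fun hs => ⟨a, b, h, hs⟩

lemma finite_leafSet : T.leafSet.Finite := by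
  have := T.finite_V
  exact Set.finite_range _

end PhyloTree

/-! ### The topmost branching of a set of leaves -/

namespace PhyloTree

variable {α : Type*} {T : PhyloTree α}

/-- Some element of `L` is separated from `x` and `y`: these leaves lie below the same child of the
last common ancestor of `L`. -/
def Near (T : PhyloTree α) (L : Set α) (x y : α) : Prop :=
  x = y ∨ ∃ z ∈ L, T.Separates x y z

lemma Near.symm {L : Set α} {x y : α} (h : T.Near L x y) : T.Near L y x := by
  rcases h with rfl | ⟨z, hz, h⟩
  exacts [Or.inl rfl, Or.inr ⟨z, hz, h.symm⟩]

lemma Near.trans {L : Set α} {x y z : α} (h : T.Near L x y) (h' : T.Near L y z) :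
    T.Near L x z := by
  rcases h with rfl | ⟨u, hu, h⟩
  · exact h'
  rcases h' with rfl | ⟨v, hv, h'⟩
  · exact Or.inr ⟨u, hu, h⟩
  -- From `xy|u` and `yz|v`, the only case without a witness for `x` and `z` is `xy|z` together with
  -- `zy|x`, which asymmetry forbids.
  rcases h.or_of_mem_leafSet h'.mem_leafSet.2.1 with h₁ | h₁
  · exact Or.inr ⟨u, hu, h₁⟩
  rcases h'.symm.or_of_mem_leafSet h.mem_leafSet.1 with h₂ | h₂
  · exact Or.inr ⟨v, hv, h₂.symm⟩
  · exact absurd h₂.symm h₁.symm.asymm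

lemma exists_not_near {L : Set α} (hL : L ⊆ T.leafSet) (hnt : L.Nontrivial) :
    ∃ x ∈ L, ∃ y ∈ L, ¬ T.Near L x y := by
  obtain ⟨a, ha, b, hb, hab⟩ := hnt
  have irr : ∀ x, ¬ T.Separates a x a := fun x h => h.symm.asymm h.symm
  -- Leaves are ordered by how high they branch off the path from `a` to the root; a minimal `m`
  -- branches off highest in `L`, so no `z ∈ L` gives `am|z`.
  have : IsStrictOrder α (fun x y => T.Separates a y x) :=
    { irrefl := fun x h => h.asymm h
      trans := fun x y z h h' => (h'.or_of_mem_leafSet h.mem_leafSet.2.2).resolve_left h.asymm }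
  have wf := (T.finite_leafSet.subset (Set.sdiff_subset.trans hL : L \ {a} ⊆ _)).wellFoundedOn
    (r := fun x y => T.Separates a y x)
  obtain ⟨m, -, hm⟩ := wf.has_min Set.univ ⟨⟨b, hb, hab.symm⟩, trivial⟩
  refine ⟨a, ha, m, m.2.1, ?_⟩
  rintro (h | ⟨z, hz, h⟩)
  · exact m.2.2 h.symm
  · by_cases hza : z = a
    · subst hza
      exact irr _ h
    · exact hm ⟨z, hz, hza⟩ trivial h

end PhyloTree

namespace Triple

variable {α : Type*}

lemma exists_pair_eq (t : Triple α) : ∃ a b, t.pair = s(a, b) ∧ a ≠ b ∧ a ≠ t.out ∧ b ≠ t.out := by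
  obtain ⟨p, c, h₁, h₂⟩ := t
  induction p with
  | _ a b =>
    simp only [Sym2.mk_isDiag_iff, Sym2.mem_iff, not_or] at h₁ h₂
    exact ⟨a, b, rfl, h₁, Ne.symm h₂.1, Ne.symm h₂.2⟩

lemma leaves_subset_iff {t : Triple α} {L : Set α} :
    t.leaves ⊆ L ↔ (∀ x ∈ t.pair, x ∈ L) ∧ t.out ∈ L :=
  ⟨fun h => ⟨fun _ hx => h (Or.inl hx), h (Or.inr rfl)⟩, by
    rintro ⟨h, h'⟩ x (hx | rfl)
    exacts [h x hx, h']⟩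

end Triple

/-! ### Aho graphs and inferred triples -/

namespace TripleSet

variable {α : Type*} {R S : Set (Triple α)} {L M A C : Set α} {x y z : α}

/-- The edges of the Aho graph `[R, L]`. -/
def Edge (R : Set (Triple α)) (L : Set α) (x y : α) : Prop :=
  ∃ t ∈ R, t.leaves ⊆ L ∧ t.pair = s(x, y)

/-- Two vertices lie in the same connected component of the Aho graph `[R, L]`. -/
def Linked (R : Set (Triple α)) (L : Set α) : α → α → Prop :=
  Relation.EqvGen (Edge R L)

lemma Edge.mem_leaves (h : Edge R L x y) : x ∈ leaves R ∧ y ∈ leaves R := by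
  obtain ⟨t, ht, hL, hp⟩ := h
  exact ⟨Set.mem_biUnion ht (Or.inl (by simp [hp])), Set.mem_biUnion ht (Or.inl (by simp [hp]))⟩

/-- The equivalence relation generated by `r` is contained in every equivalence relation containing
`r`. -/
lemma eqvGen_imp {r s : α → α → Prop} (hs : Equivalence s) (h : ∀ x y, r x y → s x y)
    (hxy : Relation.EqvGen r x y) : s x y := by
  induction hxy with
  | rel x y h' => exact h _ _ h'
  | refl x => exact hs.refl x
  | symm x y _ ih => exact hs.symm ih
  | trans x y z _ _ ih ih' => exact hs.trans ih ih'

lemma linked_equivalence (R : Set (Triple α)) (L : Set α) : Equivalence (Linked R L) :=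
  Relation.EqvGen.is_equivalence _

lemma Linked.symm (h : Linked R L x y) : Linked R L y x := (linked_equivalence R L).symm h

lemma Linked.trans (h : Linked R L x y) (h' : Linked R L y z) : Linked R L x z :=
  (linked_equivalence R L).trans h h'

lemma Linked.mono (hRS : R ⊆ S) (hLM : L ⊆ M) (h : Linked R L x y) : Linked S M x y :=
  eqvGen_imp (linked_equivalence S M)
    (fun _ _ ⟨t, ht, hL, hp⟩ => .rel _ _ ⟨t, hRS ht, hL.trans hLM, hp⟩) h

lemma linked_pair {t : Triple α} (ht : t ∈ R) (hL : t.leaves ⊆ L) (hp : t.pair = s(x, y)) :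
    Linked R L x y :=
  .rel _ _ ⟨t, ht, hL, hp⟩

lemma leaves_mono (h : R ⊆ S) : leaves R ⊆ leaves S := Set.biUnion_mono h fun _ _ => subset_rfl

lemma leaves_subset_of_mem {t : Triple α} (ht : t ∈ R) : t.leaves ⊆ leaves R :=
  Set.subset_biUnion_of_mem ht

/-- No Aho graph on at least two leaves is connected. -/
def AhoConsistent (R : Set (Triple α)) : Prop :=
  (leaves R).Finite ∧ ∀ L ⊆ leaves R, L.Nontrivial → ∃ x ∈ L, ∃ y ∈ L, ¬ Linked R L x y

/-- The Aho graph `[R, A ∪ C]` is connected on `A` and on `C`. -/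
def Split (R : Set (Triple α)) (A C : Set α) : Prop :=
  (∀ x ∈ A, ∀ y ∈ A, Linked R (A ∪ C) x y) ∧ ∀ x ∈ C, ∀ y ∈ C, Linked R (A ∪ C) x y

lemma Split.symm (h : Split R A C) : Split R C A := by
  rw [Split, Set.union_comm]
  exact ⟨h.2, h.1⟩

lemma Split.mono (hRS : R ⊆ S) (h : Split R A C) : Split S A C :=
  ⟨fun x hx y hy => (h.1 x hx y hy).mono hRS subset_rfl,
    fun x hx y hy => (h.2 x hx y hy).mono hRS subset_rfl⟩

/-- The triple `t` has its pair in `A` and its third leaf in `C`. -/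
def Crosses (t : Triple α) (A C : Set α) : Prop :=
  (∀ x ∈ t.pair, x ∈ A) ∧ t.out ∈ C

/-- The triple `t` crosses a two-component Aho graph of `R`. -/
def Inferred (R : Set (Triple α)) (t : Triple α) : Prop :=
  ∃ A C, A ∪ C ⊆ leaves R ∧ Split R A C ∧ Crosses t A C

/-- The third leaf of the triple behind an edge lies in `L` and witnesses nearness, which is an
equivalence relation. -/
lemma near_of_linked {T : PhyloTree α} (hR : R ⊆ T.triples) (h : Linked R L x y) :
    T.Near L x y :=
  eqvGen_imp (s := T.Near L) ⟨fun _ => Or.inl rfl, fun h => h.symm, fun h h' => h.trans h'⟩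
    (fun _ _ ⟨_, ht, hL, hp⟩ =>
      Or.inr ⟨_, hL (Or.inr rfl), (PhyloTree.mem_triples_iff hp).1 (hR ht)⟩) h

lemma leaves_subset_leafSet {T : PhyloTree α} (hR : R ⊆ T.triples) : leaves R ⊆ T.leafSet := by
  refine Set.iUnion₂_subset fun t ht => ?_
  obtain ⟨a, b, hp, hs⟩ := hR ht
  rw [Triple.leaves_subset_iff, hp]
  have := hs.mem_leafSet
  simp [this.1, this.2.1, this.2.2]

lemma Consistent.ahoConsistent (h : Consistent R) : AhoConsistent R := by
  obtain ⟨T, hT⟩ := h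
  refine ⟨T.finite_leafSet.subset (leaves_subset_leafSet hT), fun L hL hnt => ?_⟩
  obtain ⟨x, hx, y, hy, hxy⟩ := T.exists_not_near (hL.trans (leaves_subset_leafSet hT)) hnt
  exact ⟨x, hx, y, hy, fun h => hxy (near_of_linked hT h)⟩

/-- `A` and `C` each lie in one nearness class, and `A ∪ C` meets at least two, so these classes
differ. From `ab|e` one gets `ac|e` or `ab|c`, and the former would make `a` and `c` near. -/
lemma Inferred.mem_triples {T : PhyloTree α} (hT : R ⊆ T.triples) {t : Triple α}
    (h : Inferred R t) : t ∈ T.triples := by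
  obtain ⟨A, C, hAC, ⟨hA, hC⟩, hp, ho⟩ := h
  obtain ⟨a, b, hab, hne, hao, hbo⟩ := t.exists_pair_eq
  have ha := hp a (by simp [hab])
  have hb := hp b (by simp [hab])
  rw [PhyloTree.mem_triples_iff hab]
  have hL := hAC.trans (leaves_subset_leafSet hT)
  have hAn : ∀ x ∈ A, T.Near (A ∪ C) a x := fun x hx => near_of_linked hT (hA a ha x hx)
  have hCn : ∀ x ∈ C, T.Near (A ∪ C) t.out x := fun x hx => near_of_linked hT (hC _ ho x hx)
  have hfar : ¬ T.Near (A ∪ C) a t.out := by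
    intro hac
    obtain ⟨x, hx, y, hy, hxy⟩ := T.exists_not_near hL ⟨a, Or.inl ha, t.out, Or.inr ho, hao⟩
    have all : ∀ x ∈ A ∪ C, T.Near (A ∪ C) a x := by
      rintro x (hx | hx)
      exacts [hAn x hx, hac.trans (hCn x hx)]
    exact hxy ((all x hx).symm.trans (all y hy))
  rcases hAn b hb with h | ⟨e, he, h⟩
  · exact absurd h hne
  rcases h.or_of_mem_leafSet (hL (Or.inr ho)) with h' | h'
  · exact absurd (Or.inr ⟨e, he, h'⟩) hfar
  · exact h'

end TripleSet

/-! ### Trees from laminar families -/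

namespace SimpleGraph

variable {V : Type*}

/-- The graph in which every vertex is joined to its parent. -/
def parentGraph (par : V → V) : SimpleGraph V :=
  fromRel fun u v => par u = v

lemma parentGraph_adj {par : V → V} {u v : V} :
    (parentGraph par).Adj u v ↔ u ≠ v ∧ (par u = v ∨ par v = u) :=
  Iff.rfl

/-- Parents lead down in rank to `ρ`, which gives connectedness; the edges correspond to the
vertices other than `ρ`, so their number is one less than that of the vertices. -/
lemma isTree_parentGraph [Finite V] {par : V → V} {ρ : V} (hρ : par ρ = ρ) (rank : V → ℕ)
    (h : ∀ v, v ≠ ρ → rank (par v) < rank v) : (parentGraph par).IsTree := by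
  have hne : ∀ v, v ≠ ρ → v ≠ par v := fun v hv h' => (h v hv).ne (congrArg rank h'.symm)
  rw [isTree_iff_connected_and_card]
  constructor
  · have reach : ∀ n v, rank v = n → (parentGraph par).Reachable v ρ := by
      intro n
      induction n using Nat.strong_induction_on with
      | _ n ih =>
        intro v hv
        by_cases hvρ : v = ρ
        · rw [hvρ]
        · have hadj : (parentGraph par).Adj v (par v) := ⟨hne v hvρ, Or.inl rfl⟩
          exact hadj.reachable.trans (ih _ (hv ▸ h v hvρ) _ rfl)
    exact (connected_iff_exists_forall_reachable _).2 ⟨ρ, fun v => (reach _ v rfl).symm⟩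
  · have himg : (parentGraph par).edgeSet = (fun v => s(v, par v)) '' {ρ}ᶜ := by
      ext e
      induction e with
      | _ u v =>
        simp only [mem_edgeSet, parentGraph_adj, Set.mem_image, Set.mem_compl_iff,
          Set.mem_singleton_iff, Sym2.eq_iff]
        constructor
        · rintro ⟨huv, rfl | rfl⟩
          · exact ⟨u, fun hu => huv (by rw [hu, hρ]), Or.inl ⟨rfl, rfl⟩⟩
          · exact ⟨v, fun hu => huv (by rw [hu, hρ]), Or.inr ⟨rfl, rfl⟩⟩
        · rintro ⟨w, hw, ⟨rfl, rfl⟩ | ⟨rfl, rfl⟩⟩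
          · exact ⟨hne w hw, Or.inl rfl⟩
          · exact ⟨(hne w hw).symm, Or.inr rfl⟩
    have hinj : Set.InjOn (fun v => s(v, par v)) {ρ}ᶜ := by
      intro u hu w hw huw
      rcases Sym2.eq_iff.1 huw with ⟨h', -⟩ | ⟨h₁, h₂⟩
      · exact h'
      · have := h u hu
        have := h w hw
        rw [h₂] at *
        rw [← h₁] at *
        omega
    rw [himg, Nat.card_coe_set_eq, hinj.ncard_image,
      ← Set.ncard_add_ncard_compl {ρ}, Set.ncard_singleton, add_comm]

end SimpleGraph

/-- A finite laminar family of nonempty sets that contains its union, which has at least two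
elements, and all singletons. -/
structure ClusterSystem (α : Type*) where
  V : Type
  finite_V : Finite V
  cl : V → Set α
  cl_injective : Function.Injective cl
  root : V
  cl_subset_root : ∀ v, cl v ⊆ cl root
  root_nontrivial : (cl root).Nontrivial
  cl_nonempty : ∀ v, (cl v).Nonempty
  laminar : ∀ u v, cl u ⊆ cl v ∨ cl v ⊆ cl u ∨ Disjoint (cl u) (cl v)
  exists_singleton : ∀ x ∈ cl root, ∃ v, cl v = {x}

namespace ClusterSystem

variable {α : Type*} (H : ClusterSystem α)

lemma ssubset_root {v : H.V} (hv : v ≠ H.root) : H.cl v ⊂ H.cl H.root :=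
  (H.cl_subset_root v).ssubset_of_ne fun h => hv (H.cl_injective h)

lemma exists_parent (v : H.V) (hv : v ≠ H.root) :
    ∃ p, H.cl v ⊂ H.cl p ∧ ∀ w, H.cl v ⊂ H.cl w → H.cl p ⊆ H.cl w := by
  have := H.finite_V
  obtain ⟨p, hp⟩ := (Set.toFinite {w | H.cl v ⊂ H.cl w}).exists_minimalFor H.cl _
    ⟨H.root, H.ssubset_root hv⟩
  refine ⟨p, hp.1, fun w hw => ?_⟩
  rcases H.laminar p w with h | h | h
  · exact h
  · exact hp.2 hw h
  · obtain ⟨x, hx⟩ := H.cl_nonempty v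
    exact absurd (hw.1 hx) (Set.disjoint_left.1 h (hp.1.1 hx))

open Classical in
/-- The smallest proper supercluster of a cluster; the root is its own parent. -/
noncomputable def par (v : H.V) : H.V :=
  if hv : v = H.root then H.root else (H.exists_parent v hv).choose

lemma par_root : H.par H.root = H.root := by simp [par]

lemma ssubset_par {v : H.V} (hv : v ≠ H.root) : H.cl v ⊂ H.cl (H.par v) := by
  rw [par, dif_neg hv]
  exact (H.exists_parent v hv).choose_spec.1

lemma par_subset {v w : H.V} (h : H.cl v ⊂ H.cl w) : H.cl (H.par v) ⊆ H.cl w := by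
  have hv : v ≠ H.root := by
    rintro rfl
    exact h.2 (H.cl_subset_root w)
  rw [par, dif_neg hv]
  exact (H.exists_parent v hv).choose_spec.2 w h

/-- The number of superclusters of a cluster. -/
noncomputable def depth (v : H.V) : ℕ := {w | H.cl v ⊆ H.cl w}.ncard

lemma depth_lt {u v : H.V} (h : H.cl u ⊂ H.cl v) : H.depth v < H.depth u := by
  have := H.finite_V
  exact Set.ncard_lt_ncard ⟨fun w hw => h.1.trans hw, fun h' => h.2 (h' (subset_rfl : H.cl u ⊆ _))⟩

lemma isTree : (SimpleGraph.parentGraph H.par).IsTree :=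
  have := H.finite_V
  SimpleGraph.isTree_parentGraph H.par_root H.depth fun _ hv => H.depth_lt (H.ssubset_par hv)

/-- A maximal cluster among those containing `x` and properly contained in `H.cl v` has parent `v`.
-/
lemma exists_child {v : H.V} {x : α} (hx : x ∈ H.cl v) (hv : H.cl v ≠ {x}) :
    ∃ u, H.par u = v ∧ H.cl u ⊂ H.cl v ∧ x ∈ H.cl u := by
  have := H.finite_V
  obtain ⟨s, hs⟩ := H.exists_singleton x (H.cl_subset_root v hx)
  obtain ⟨u, hu⟩ := (Set.toFinite {w | x ∈ H.cl w ∧ H.cl w ⊂ H.cl v}).exists_maximalFor H.cl _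
    ⟨s, by simp [hs], by rw [hs]; exact (Set.singleton_subset_iff.2 hx).ssubset_of_ne hv.symm⟩
  obtain ⟨⟨hxu, huv⟩, hmax⟩ := hu
  refine ⟨u, ?_, huv, hxu⟩
  by_contra hne
  have hur : u ≠ H.root := by
    rintro rfl
    exact huv.2 (H.cl_subset_root v)
  have h₁ := H.ssubset_par hur
  have h₂ : H.cl (H.par u) ⊂ H.cl v :=
    (H.par_subset huv).ssubset_of_ne fun h => hne (H.cl_injective h)
  exact h₁.2 (hmax ⟨h₁.1 hxu, h₂⟩ h₁.1)

lemma exists_two_children {v : H.V} (hv : (H.cl v).Nontrivial) :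
    ∃ u₁ u₂, u₁ ≠ u₂ ∧ (H.par u₁ = v ∧ H.cl u₁ ⊂ H.cl v) ∧ (H.par u₂ = v ∧ H.cl u₂ ⊂ H.cl v) := by
  obtain ⟨x, hx⟩ := hv.nonempty
  obtain ⟨u₁, h₁, h₁', -⟩ := H.exists_child hx hv.ne_singleton
  obtain ⟨y, hy, hy'⟩ := Set.exists_of_ssubset h₁'
  obtain ⟨u₂, h₂, h₂', hyu⟩ := H.exists_child hy hv.ne_singleton
  refine ⟨u₁, u₂, ?_, ⟨h₁, h₁'⟩, h₂, h₂'⟩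
  rintro rfl
  exact hy' hyu

lemma ncard_neighborSet_of_eq_singleton {v : H.V} {x : α} (hv : H.cl v = {x}) :
    ((SimpleGraph.parentGraph H.par).neighborSet v).ncard = 1 := by
  have hvr : v ≠ H.root := by
    rintro rfl
    exact H.root_nontrivial.ne_singleton hv
  rw [Set.ncard_eq_one]
  refine ⟨H.par v, Set.eq_singleton_iff_unique_mem.2 ⟨⟨fun h => ?_, Or.inl rfl⟩, ?_⟩⟩
  · exact (H.ssubset_par hvr).ne (congrArg H.cl h)
  · rintro u ⟨hne, h | h⟩
    · exact h.symm
    · have hur : u ≠ H.root := by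
        rintro rfl
        exact hvr (h.symm.trans H.par_root)
      have := H.ssubset_par hur
      rw [h, hv, Set.ssubset_singleton_iff] at this
      exact absurd this (H.cl_nonempty u).ne_empty

lemma three_le_ncard_neighborSet {v : H.V} (hv : (H.cl v).Nontrivial) (hvr : v ≠ H.root) :
    3 ≤ ((SimpleGraph.parentGraph H.par).neighborSet v).ncard := by
  have := H.finite_V
  obtain ⟨u₁, u₂, hne, ⟨h₁, h₁'⟩, h₂, h₂'⟩ := H.exists_two_children hv
  have hp := H.ssubset_par hvr
  have e : ({H.par v, u₁, u₂} : Set H.V).ncard = 3 :=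
    Set.ncard_eq_three.2 ⟨_, _, _, fun h => (h₁'.trans hp).ne (congrArg H.cl h.symm),
      fun h => (h₂'.trans hp).ne (congrArg H.cl h.symm), hne, rfl⟩
  rw [← e]
  refine Set.ncard_le_ncard ?_
  rintro w (rfl | rfl | rfl)
  · exact ⟨fun h => hp.ne (congrArg H.cl h), Or.inl rfl⟩
  · exact ⟨fun h => h₁'.ne (congrArg H.cl h.symm), Or.inr h₁⟩
  · exact ⟨fun h => h₂'.ne (congrArg H.cl h.symm), Or.inr h₂⟩

/-- This covers the root, which has no parent edge and only needs degree different from one. -/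
lemma two_le_ncard_neighborSet {v : H.V} (hv : (H.cl v).Nontrivial) :
    2 ≤ ((SimpleGraph.parentGraph H.par).neighborSet v).ncard := by
  have := H.finite_V
  obtain ⟨u₁, u₂, hne, ⟨h₁, h₁'⟩, h₂, h₂'⟩ := H.exists_two_children hv
  rw [← Set.ncard_pair hne]
  refine Set.ncard_le_ncard ?_
  rintro w (rfl | rfl)
  · exact ⟨fun h => h₁'.ne (congrArg H.cl h.symm), Or.inr h₁⟩
  · exact ⟨fun h => h₂'.ne (congrArg H.cl h.symm), Or.inr h₂⟩

lemma exists_eq_singleton {v : H.V}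
    (hv : ((SimpleGraph.parentGraph H.par).neighborSet v).ncard = 1) : ∃ x, H.cl v = {x} := by
  rcases (H.cl_nonempty v).exists_eq_singleton_or_nontrivial with h | h
  · exact h
  · have := H.two_le_ncard_neighborSet h
    omega

/-- The phylogenetic tree of a cluster system. -/
noncomputable def toPhyloTree : PhyloTree α where
  V := H.V
  finite_V := H.finite_V
  graph := SimpleGraph.parentGraph H.par
  isTree := H.isTree
  root := H.root
  root_inner := by
    have := H.two_le_ncard_neighborSet H.root_nontrivial
    omega
  three_le_degree v hv h := by
    rcases (H.cl_nonempty v).exists_eq_singleton_or_nontrivial with ⟨x, hx⟩ | h'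
    · exact absurd (H.ncard_neighborSet_of_eq_singleton hx) h
    · exact H.three_le_ncard_neighborSet h' hv
  label :=
    { toFun := fun v => (H.exists_eq_singleton v.2).choose
      inj' := fun u v h => Subtype.ext <| H.cl_injective <|
        (H.exists_eq_singleton u.2).choose_spec.trans
          ((congrArg _ h).trans (H.exists_eq_singleton v.2).choose_spec.symm) }

lemma cl_eq_label (v : {v : H.V // (H.toPhyloTree.graph.neighborSet v).ncard = 1}) :
    H.cl v.1 = {H.toPhyloTree.label v} :=
  (H.exists_eq_singleton v.2).choose_spec

lemma exists_label {x : α} (hx : x ∈ H.cl H.root) :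
    ∃ v, H.toPhyloTree.label v = x ∧ H.cl v.1 = {x} := by
  obtain ⟨v, hv⟩ := H.exists_singleton x hx
  refine ⟨⟨v, H.ncard_neighborSet_of_eq_singleton hv⟩, ?_, hv⟩
  have := H.cl_eq_label ⟨v, H.ncard_neighborSet_of_eq_singleton hv⟩
  exact (Set.singleton_injective (hv.symm.trans this)).symm

lemma leafSet_toPhyloTree : H.toPhyloTree.leafSet = H.cl H.root := by
  ext x
  constructor
  · rintro ⟨v, rfl⟩
    exact H.cl_subset_root v.1 ((H.cl_eq_label v).ge (Set.mem_singleton _))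
  · intro hx
    obtain ⟨v, hv, -⟩ := H.exists_label hx
    exact ⟨v, hv⟩

lemma exists_walk_up {u v : H.V} (h : H.cl u ⊆ H.cl v) :
    ∃ p : (SimpleGraph.parentGraph H.par).Walk u v,
      ∀ w ∈ p.support, H.cl u ⊆ H.cl w ∧ H.cl w ⊆ H.cl v := by
  induction hn : H.depth u using Nat.strong_induction_on generalizing u with
  | _ n ih =>
    by_cases huv : u = v
    · subst huv
      exact ⟨.nil, by simp⟩
    · have hlt : H.cl u ⊂ H.cl v := h.ssubset_of_ne fun h' => huv (H.cl_injective h')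
      have hur : u ≠ H.root := by
        rintro rfl
        exact hlt.2 (H.cl_subset_root v)
      have hp := H.ssubset_par hur
      obtain ⟨p, hp'⟩ := ih _ (hn ▸ H.depth_lt hp) (H.par_subset hlt) rfl
      have hadj : (SimpleGraph.parentGraph H.par).Adj u (H.par u) :=
        ⟨fun h => hp.ne (congrArg H.cl h), Or.inl rfl⟩
      refine ⟨.cons hadj p, fun w hw => ?_⟩
      rw [SimpleGraph.Walk.support_cons, List.mem_cons] at hw
      rcases hw with rfl | hw
      · exact ⟨subset_rfl, h⟩
      · exact ⟨hp.1.trans (hp' w hw).1, (hp' w hw).2⟩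

lemma exists_walk_below {x y v : H.V} (hx : H.cl x ⊆ H.cl v) (hy : H.cl y ⊆ H.cl v) :
    ∃ p : (SimpleGraph.parentGraph H.par).Walk x y, ∀ w ∈ p.support, H.cl w ⊆ H.cl v := by
  obtain ⟨p, hp⟩ := H.exists_walk_up hx
  obtain ⟨q, hq⟩ := H.exists_walk_up hy
  refine ⟨p.append q.reverse, fun w hw => ?_⟩
  rw [SimpleGraph.Walk.mem_support_append_iff, SimpleGraph.Walk.support_reverse,
    List.mem_reverse] at hw
  rcases hw with hw | hw
  exacts [(hp w hw).2, (hq w hw).2]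

/-- The path from `a` to `b` stays inside subclusters of `H.cl v`, whereas all clusters on the path
from `c` to the root contain `c`. -/
lemma separates_toPhyloTree {v : H.V} {a b c : α} (ha : a ∈ H.cl v) (hb : b ∈ H.cl v)
    (hc : c ∈ H.cl H.root) (hcv : c ∉ H.cl v) : H.toPhyloTree.Separates a b c := by
  classical
  obtain ⟨x, hx, hx'⟩ := H.exists_label (H.cl_subset_root v ha)
  obtain ⟨y, hy, hy'⟩ := H.exists_label (H.cl_subset_root v hb)
  obtain ⟨z, hz, hz'⟩ := H.exists_label hc
  obtain ⟨p, hp⟩ := H.exists_walk_below (x := x.1) (y := y.1) (v := v)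
    (hx'.le.trans (Set.singleton_subset_iff.2 ha)) (hy'.le.trans (Set.singleton_subset_iff.2 hb))
  obtain ⟨r, hr⟩ := H.exists_walk_up (H.cl_subset_root z.1)
  refine ⟨x, y, z, hx, hy, hz, p.toPath, r.toPath, fun u hu hu' => ?_⟩
  have hu := hp u (p.support_bypass_subset_support hu)
  have hu' := hr u (r.support_bypass_subset_support hu')
  exact hcv (hu (hu'.1 (hz'.ge rfl)))

end ClusterSystem

/-- The tree consisting of the root only. -/
def PhyloTree.trivial (α : Type*) : PhyloTree α where
  V := Unit
  finite_V := inferInstance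
  graph := ⊥
  isTree := ⟨SimpleGraph.Connected.of_subsingleton, SimpleGraph.isAcyclic_bot⟩
  root := ()
  root_inner := by simp [SimpleGraph.neighborSet]
  three_le_degree v hv := absurd rfl hv
  label := ⟨fun v => absurd v.2 (by simp [SimpleGraph.neighborSet]),
    fun v => absurd v.2 (by simp [SimpleGraph.neighborSet])⟩

lemma PhyloTree.leafSet_trivial (α : Type*) : (PhyloTree.trivial α).leafSet = ∅ := by
  rw [leafSet, Set.range_eq_empty_iff]
  exact ⟨fun v => absurd v.2 (by simp [SimpleGraph.neighborSet, trivial])⟩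

/-! ### The algorithm BUILD -/

namespace TripleSet

variable {α : Type*} {R : Set (Triple α)}

lemma AhoConsistent.exists_laminar (hR : AhoConsistent R) {L : Set α} (hL : L ⊆ leaves R)
    (hne : L.Nonempty) :
    ∃ H : Set (Set α), H.Finite ∧ L ∈ H ∧ (∀ C ∈ H, C ⊆ L ∧ C.Nonempty) ∧ (∀ x ∈ L, {x} ∈ H) ∧
      (∀ C ∈ H, ∀ D ∈ H, C ⊆ D ∨ D ⊆ C ∨ Disjoint C D) ∧
      ∀ t ∈ R, t.leaves ⊆ L → ∃ C ∈ H, (∀ x ∈ t.pair, x ∈ C) ∧ t.out ∉ C := by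
  induction hn : L.ncard using Nat.strong_induction_on generalizing L with
  | _ n ih =>
    rcases hne.exists_eq_singleton_or_nontrivial with ⟨a, rfl⟩ | hnt
    · refine ⟨{{a}}, Set.finite_singleton _, rfl, by simp, by simp, by simp, fun t _ hta => ?_⟩
      obtain ⟨x, y, hp, -, hx, -⟩ := t.exists_pair_eq
      have h₁ : x = a := hta (Or.inl (by simp [hp]))
      have h₂ : t.out = a := hta (Or.inr rfl)
      exact absurd (h₁.trans h₂.symm) hx
    obtain ⟨x, hx, y, hy, hxy⟩ := hR.2 L hL hnt
    have hfin : L.Finite := hR.1.subset hL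
    -- One component against the union of all others: since no edge joins the two sides, each pair
    -- lies on one side. That side is the required cluster if the third leaf is on the other;
    -- otherwise the triple is handled recursively.
    let A : Set α := {z ∈ L | Linked R L x z}
    let B : Set α := {z ∈ L | ¬ Linked R L x z}
    have hAL : A ⊆ L := fun _ h => h.1
    have hBL : B ⊆ L := fun _ h => h.1
    have hxA : x ∈ A := ⟨hx, (linked_equivalence R L).refl x⟩
    have hyB : y ∈ B := ⟨hy, hxy⟩
    have hdis : Disjoint A B := Set.disjoint_left.2 fun _ h h' => h'.2 h.2
    obtain ⟨HA, fA, memA, subA, sinA, lamA, triA⟩ := ih A.ncard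
      (hn ▸ Set.ncard_lt_ncard ⟨hAL, fun h => hyB.2 (h hy).2⟩ hfin) (hAL.trans hL) ⟨x, hxA⟩ rfl
    obtain ⟨HB, fB, memB, subB, sinB, lamB, triB⟩ := ih B.ncard
      (hn ▸ Set.ncard_lt_ncard ⟨hBL, fun h => (h hx).2 hxA.2⟩ hfin) (hBL.trans hL) ⟨y, hyB⟩ rfl
    refine ⟨{L} ∪ (HA ∪ HB), (Set.finite_singleton _).union (fA.union fB), Or.inl rfl, ?_, ?_, ?_,
      ?_⟩
    · rintro C (rfl | hC | hC)
      exacts [⟨subset_rfl, hne⟩, ⟨(subA C hC).1.trans hAL, (subA C hC).2⟩,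
        ⟨(subB C hC).1.trans hBL, (subB C hC).2⟩]
    · intro z hz
      by_cases h : Linked R L x z
      exacts [Or.inr (Or.inl (sinA z ⟨hz, h⟩)), Or.inr (Or.inr (sinB z ⟨hz, h⟩))]
    · have hsub : ∀ C ∈ HA ∪ HB, C ⊆ L := by
        rintro C (hC | hC)
        exacts [(subA C hC).1.trans hAL, (subB C hC).1.trans hBL]
      rintro C (rfl | hC) D (rfl | hD)
      · exact Or.inl subset_rfl
      · exact Or.inr (Or.inl (hsub D hD))
      · exact Or.inl (hsub C hC)
      · rcases hC with hC | hC <;> rcases hD with hD | hD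
        · exact lamA C hC D hD
        · exact Or.inr (Or.inr (hdis.mono (subA C hC).1 (subB D hD).1))
        · exact Or.inr (Or.inr (hdis.symm.mono (subB C hC).1 (subA D hD).1))
        · exact lamB C hC D hD
    · intro t ht htL
      obtain ⟨a, b, hp, -⟩ := t.exists_pair_eq
      have hab : Linked R L a b := linked_pair ht htL hp
      obtain ⟨hpL, hoL⟩ := Triple.leaves_subset_iff.1 htL
      have haL := hpL a (by simp [hp])
      have hbL := hpL b (by simp [hp])
      by_cases ha : Linked R L x a
      · have hpA : ∀ z ∈ t.pair, z ∈ A := by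
          simp only [hp, Sym2.mem_iff]
          rintro z (rfl | rfl)
          exacts [⟨haL, ha⟩, ⟨hbL, ha.trans hab⟩]
        by_cases ho : Linked R L x t.out
        · obtain ⟨C, hC, h⟩ := triA t ht (Triple.leaves_subset_iff.2 ⟨hpA, hoL, ho⟩)
          exact ⟨C, Or.inr (Or.inl hC), h⟩
        · exact ⟨A, Or.inr (Or.inl memA), hpA, fun h => ho h.2⟩
      · have hpB : ∀ z ∈ t.pair, z ∈ B := by
          simp only [hp, Sym2.mem_iff]
          rintro z (rfl | rfl)
          exacts [⟨haL, ha⟩, ⟨hbL, fun h => ha (h.trans hab.symm)⟩]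
        by_cases ho : Linked R L x t.out
        · exact ⟨B, Or.inr (Or.inr memB), hpB, fun h => h.2 ho⟩
        · obtain ⟨C, hC, h⟩ := triB t ht (Triple.leaves_subset_iff.2 ⟨hpB, hoL, ho⟩)
          exact ⟨C, Or.inr (Or.inr hC), h⟩

/-- The algorithm BUILD: if no Aho graph is connected, then some tree on `L_R` displays `R`. -/
lemma AhoConsistent.span_nonempty (hR : AhoConsistent R) : (span R).Nonempty := by
  rcases R.eq_empty_or_nonempty with rfl | ⟨t₀, ht₀⟩
  -- A cluster system has at least two leaves, so `R = ∅` needs the tree without leaves.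
  · exact ⟨PhyloTree.trivial α, by simp [PhyloTree.leafSet_trivial, leaves], Set.empty_subset _⟩
  obtain ⟨a, b, hp, hab, -⟩ := t₀.exists_pair_eq
  have ha : a ∈ leaves R := leaves_subset_of_mem ht₀ (Or.inl (by simp [hp]))
  have hb : b ∈ leaves R := leaves_subset_of_mem ht₀ (Or.inl (by simp [hp]))
  obtain ⟨H, hfin, hmem, hsub, hsin, hlam, htri⟩ := hR.exists_laminar subset_rfl ⟨a, ha⟩
  have := hfin.to_subtype
  obtain ⟨n, ⟨e⟩⟩ := Finite.exists_equiv_fin H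
  have he : ∀ C (hC : C ∈ H), (e.symm (e ⟨C, hC⟩)).1 = C := fun C hC => by
    rw [e.symm_apply_apply]
  -- The clusters are indexed by `Fin n` because tree vertices must form a type in `Type`, whatever
  -- the universe of `α`.
  let K : ClusterSystem α :=
    { V := Fin n
      finite_V := inferInstance
      cl := fun i => (e.symm i).1
      cl_injective := Subtype.val_injective.comp e.symm.injective
      root := e ⟨leaves R, hmem⟩
      cl_subset_root := fun i => by rw [he]; exact (hsub _ (e.symm i).2).1
      root_nontrivial := by rw [he]; exact ⟨a, ha, b, hb, hab⟩
      cl_nonempty := fun i => (hsub _ (e.symm i).2).2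
      laminar := fun i j => hlam _ (e.symm i).2 _ (e.symm j).2
      exists_singleton := fun x hx => ⟨e ⟨{x}, hsin x ((he _ hmem).le hx)⟩, he _ _⟩ }
  have hroot : K.cl K.root = leaves R := he _ hmem
  refine ⟨K.toPhyloTree, K.leafSet_toPhyloTree.trans hroot, fun t ht => ?_⟩
  obtain ⟨C, hC, hpC, hoC⟩ := htri t ht (leaves_subset_of_mem ht)
  obtain ⟨x, y, hxy, -⟩ := t.exists_pair_eq
  have hcl : K.cl (e ⟨C, hC⟩) = C := he _ hC
  rw [PhyloTree.mem_triples_iff hxy]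
  exact K.separates_toPhyloTree (v := e ⟨C, hC⟩) (by rw [hcl]; exact hpC x (by simp [hxy]))
    (by rw [hcl]; exact hpC y (by simp [hxy]))
    (by rw [hroot]; exact leaves_subset_of_mem ht (Or.inr rfl)) (by rwa [hcl])

end TripleSet

/-! ### The closure in terms of Aho graphs -/

namespace TripleSet

variable {α : Type*} {R S : Set (Triple α)} {L A C : Set α}

/-- Connectivity after adding a single edge. -/
lemma eqvGen_or_of_single {r r' : α → α → Prop} {p q u v : α}
    (h : ∀ x y, r' x y → r x y ∨ s(x, y) = s(p, q)) (huv : Relation.EqvGen r' u v) :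
    Relation.EqvGen r u v ∨
      (Relation.EqvGen r u p ∨ Relation.EqvGen r u q) ∧
        (Relation.EqvGen r v p ∨ Relation.EqvGen r v q) := by
  have hr := Relation.EqvGen.is_equivalence r
  refine eqvGen_imp (s := fun u v => Relation.EqvGen r u v ∨
      (Relation.EqvGen r u p ∨ Relation.EqvGen r u q) ∧
        (Relation.EqvGen r v p ∨ Relation.EqvGen r v q)) ⟨fun x => Or.inl (hr.refl x), ?_, ?_⟩ ?_ huv
  · rintro x y (h | h)
    exacts [Or.inl (hr.symm h), Or.inr h.symm]
  · rintro x y z (h | ⟨h₁, h₂⟩) (h' | ⟨h₁', h₂'⟩)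
    · exact Or.inl (hr.trans h h')
    · exact Or.inr ⟨h₁'.imp (hr.trans h) (hr.trans h), h₂'⟩
    · exact Or.inr ⟨h₁, h₂.imp (hr.trans (hr.symm h')) (hr.trans (hr.symm h'))⟩
    · exact Or.inr ⟨h₁, h₂'⟩
  · intro x y hxy
    rcases h x y hxy with h | h
    · exact Or.inl (.rel _ _ h)
    · rcases Sym2.eq_iff.1 h with ⟨rfl, rfl⟩ | ⟨rfl, rfl⟩
      exacts [Or.inr ⟨Or.inl (hr.refl _), Or.inr (hr.refl _)⟩,
        Or.inr ⟨Or.inr (hr.refl _), Or.inl (hr.refl _)⟩]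

lemma AhoConsistent.mono (hR : AhoConsistent R) (h : S ⊆ R) : AhoConsistent S := by
  refine ⟨hR.1.subset (leaves_mono h), fun L hL hnt => ?_⟩
  obtain ⟨x, hx, y, hy, hxy⟩ := hR.2 L (hL.trans (leaves_mono h)) hnt
  exact ⟨x, hx, y, hy, fun h' => hxy (h'.mono h subset_rfl)⟩

lemma leaves_insert {t : Triple α} (ht : t.leaves ⊆ leaves R) : leaves (insert t R) = leaves R := by
  rw [leaves, Set.biUnion_insert]
  exact Set.union_eq_right.2 ht

/-- Some Aho graph becomes connected by adding the single edge `pq`, so before that every vertex was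
in the component of `p` or of `q`. -/
lemma AhoConsistent.exists_of_not_insert (hR : AhoConsistent R) {t : Triple α} {p q : α}
    (hpq : t.pair = s(p, q)) (ht : t.leaves ⊆ leaves R) (hn : ¬ AhoConsistent (insert t R)) :
    ∃ L ⊆ leaves R, t.leaves ⊆ L ∧ ∀ x ∈ L, Linked R L x p ∨ Linked R L x q := by
  simp only [AhoConsistent, leaves_insert ht, hR.1, true_and] at hn
  push Not at hn
  obtain ⟨L, hL, hnt, hall⟩ := hn
  obtain ⟨x, hx, y, hy, hxy⟩ := hR.2 L hL hnt
  have htL : t.leaves ⊆ L := by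
    by_contra htL
    refine hxy (eqvGen_imp (linked_equivalence R L) ?_ (hall x hx y hy))
    rintro u v ⟨s, rfl | hs, hsL, hp⟩
    exacts [absurd hsL htL, linked_pair hs hsL hp]
  have key : ∀ u ∈ L, ∀ v ∈ L, Linked R L u v ∨
      (Linked R L u p ∨ Linked R L u q) ∧ (Linked R L v p ∨ Linked R L v q) := by
    intro u hu v hv
    refine eqvGen_or_of_single ?_ (hall u hu v hv)
    rintro u v ⟨s, rfl | hs, hsL, hp⟩
    exacts [Or.inr (hp.symm.trans hpq), Or.inl ⟨s, hs, hsL, hp⟩]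
  have hx' := ((key x hx y hy).resolve_left hxy).1
  refine ⟨L, hL, htL, fun z hz => ?_⟩
  rcases key z hz x hx with h | h
  exacts [hx'.imp h.trans h.trans, h.1]

lemma inferred_of_linked {t : Triple α} {a b : α} (hab : t.pair = s(a, b)) (hL : L ⊆ leaves R)
    (htL : t.leaves ⊆ L) (h : ∀ x ∈ L, Linked R L x a ∨ Linked R L x t.out)
    (hba : Linked R L b a) : Inferred R t := by
  have hU : {x ∈ L | Linked R L x a} ∪ {x ∈ L | Linked R L x t.out} = L := by
    ext x
    constructor
    · rintro (hx | hx) <;> exact hx.1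
    · exact fun hx => (h x hx).imp (⟨hx, ·⟩) (⟨hx, ·⟩)
  obtain ⟨hp, ho⟩ := Triple.leaves_subset_iff.1 htL
  refine ⟨{x ∈ L | Linked R L x a}, {x ∈ L | Linked R L x t.out}, by rwa [hU], ?_, ?_,
    ho, (linked_equivalence R L).refl _⟩
  · rw [Split, hU]
    exact ⟨fun x hx y hy => hx.2.trans hy.2.symm, fun x hx y hy => hx.2.trans hy.2.symm⟩
  · intro x hx
    refine ⟨hp x hx, ?_⟩
    rw [hab, Sym2.mem_iff] at hx
    rcases hx with rfl | rfl
    exacts [(linked_equivalence R L).refl _, hba]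

lemma leaves_subset_leafSet_of_mem {T : PhyloTree α} {t : Triple α} (ht : t ∈ T.triples) :
    t.leaves ⊆ T.leafSet :=
  (leaves_subset_of_mem (Set.mem_singleton t)).trans
    (leaves_subset_leafSet (Set.singleton_subset_iff.2 ht))

lemma subset_cl : R ⊆ cl R := Set.subset_iInter₂ fun _ hT => hT.2

lemma AhoConsistent.leaves_subset_of_mem_cl (hR : AhoConsistent R) {t : Triple α}
    (ht : t ∈ cl R) : t.leaves ⊆ leaves R := by
  obtain ⟨T, hT⟩ := hR.span_nonempty
  rw [← hT.1]
  exact leaves_subset_leafSet_of_mem (Set.mem_iInter₂.1 ht T hT)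

/-- The closure of `R` consists of the triples that cross a two-component Aho graph. -/
theorem AhoConsistent.mem_cl_iff (hR : AhoConsistent R) {t : Triple α} :
    t ∈ cl R ↔ Inferred R t := by
  refine ⟨fun ht => ?_, fun ht => Set.mem_iInter₂.2 fun T hT => ht.mem_triples hT.2⟩
  have htR := hR.leaves_subset_of_mem_cl ht
  obtain ⟨a, b, hab, hne, hac, hbc⟩ := t.exists_pair_eq
  obtain ⟨hp, ho⟩ := Triple.leaves_subset_iff.1 htR
  have ha := hp a (by simp [hab])
  have hb := hp b (by simp [hab])
  -- For `t = ab|c ∈ cl R`, neither `ac|b` nor `bc|a` can be added to `R`: BUILD would give a tree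
  -- in `span R` displaying two conflicting triples.
  have key : ∀ {x y : α} (t' : Triple α), t.pair = s(x, y) → t'.pair = s(x, t.out) → t'.out = y →
      t'.leaves ⊆ leaves R ∧ ¬ AhoConsistent (insert t' R) := by
    intro x y t' hxy ht' hy
    have hsub : t'.leaves ⊆ leaves R := by
      rw [Triple.leaves_subset_iff, ht', hy]
      refine ⟨fun z hz => ?_, hp y (by simp [hxy])⟩
      rcases Sym2.mem_iff.1 hz with rfl | rfl
      exacts [hp _ (by simp [hxy]), ho]
    refine ⟨hsub, fun hcon => ?_⟩
    obtain ⟨T, hT⟩ := hcon.span_nonempty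
    have h₁ := (PhyloTree.mem_triples_iff hxy).1
      (Set.mem_iInter₂.1 ht T ⟨hT.1.trans (leaves_insert hsub), (Set.subset_insert _ _).trans hT.2⟩)
    have h₂ := (PhyloTree.mem_triples_iff ht').1 (hT.2 (Set.mem_insert _ _))
    rw [hy] at h₂
    exact h₁.asymm h₂
  have mem_out : ∀ {t' : Triple α} {L : Set α}, t'.leaves ⊆ L → t'.out ∈ L :=
    fun h => h (Or.inr rfl)
  obtain ⟨h₁, h₁'⟩ := key ⟨s(a, t.out), b, by simpa using hac, by simp [hne.symm, hbc]⟩ hab rfl rfl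
  obtain ⟨h₂, h₂'⟩ := key ⟨s(b, t.out), a, by simpa using hbc, by simp [hne, hac]⟩
    (hab.trans Sym2.eq_swap) rfl rfl
  obtain ⟨L₁, hL₁, ht₁, hall₁⟩ := hR.exists_of_not_insert rfl h₁ h₁'
  obtain ⟨L₂, hL₂, ht₂, hall₂⟩ := hR.exists_of_not_insert rfl h₂ h₂'
  rw [Triple.leaves_subset_iff] at ht₁ ht₂
  simp only [Sym2.mem_iff, forall_eq_or_imp, forall_eq] at ht₁ ht₂
  obtain ⟨⟨ha₁, ho₁⟩, hb₁⟩ := ht₁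
  obtain ⟨⟨hb₂, ho₂⟩, ha₂⟩ := ht₂
  rcases hall₁ b hb₁ with hba | hbo
  · refine inferred_of_linked hab hL₁ ?_ hall₁ hba
    rw [Triple.leaves_subset_iff, hab]
    simp [ha₁, hb₁, ho₁]
  rcases hall₂ a ha₂ with hab' | hao
  · refine inferred_of_linked (hab.trans Sym2.eq_swap) hL₂ ?_ hall₂ hab'
    rw [Triple.leaves_subset_iff, hab]
    simp [ha₂, hb₂, ho₂]
  -- Now `b` is linked to `c` in `L₁` and `a` to `c` in `L₂`, which makes the Aho graph on `L₁ ∪ L₂`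
  -- connected.
  exfalso
  obtain ⟨x, hx, y, hy, hxy⟩ := hR.2 (L₁ ∪ L₂) (Set.union_subset hL₁ hL₂)
    ⟨a, Or.inl ha₁, b, Or.inl hb₁, hne⟩
  have hbo' : Linked R (L₁ ∪ L₂) b t.out := hbo.mono subset_rfl Set.subset_union_left
  have hao' : Linked R (L₁ ∪ L₂) a t.out := hao.mono subset_rfl Set.subset_union_right
  have all : ∀ x ∈ L₁ ∪ L₂, Linked R (L₁ ∪ L₂) x t.out := by
    rintro x (hx | hx)
    · rcases hall₁ x hx with h | h
      exacts [(h.mono subset_rfl Set.subset_union_left).trans hao',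
        h.mono subset_rfl Set.subset_union_left]
    · rcases hall₂ x hx with h | h
      exacts [(h.mono subset_rfl Set.subset_union_right).trans hbo',
        h.mono subset_rfl Set.subset_union_right]
  exact hxy ((all x hx).trans (all y hy).symm)

/-- Equality of closures reduces to `R ⊆ cl S`: then `S` and `R` have the same leaves and the same
spanning trees. -/
theorem AhoConsistent.mem_sc_iff (hR : AhoConsistent R) :
    S ∈ sc R ↔ S ⊆ R ∧ ∀ t ∈ R, Inferred S t := by
  refine and_congr_right fun hSR => ?_
  have hS := hR.mono hSR
  constructor
  · intro h t ht
    rw [← hS.mem_cl_iff, h]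
    exact subset_cl ht
  · intro h
    have hsub : R ⊆ cl S := fun t ht => hS.mem_cl_iff.2 (h t ht)
    have hleaves : leaves S = leaves R := (leaves_mono hSR).antisymm <|
      Set.iUnion₂_subset fun t ht => hS.leaves_subset_of_mem_cl (hsub ht)
    have hspan : span S = span R := by
      ext T
      refine ⟨fun hT => ⟨hT.1.trans hleaves, fun t ht => Set.mem_iInter₂.1 (hsub ht) T hT⟩,
        fun hT => ⟨hT.1.trans hleaves.symm, hSR.trans hT.2⟩⟩
    rw [cl, cl, hspan]

end TripleSet

/-! ### Largest splits and scopes -/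

namespace TripleSet

variable {α : Type*} {R S : Set (Triple α)} {A C : Set α} {s t : Triple α}

lemma inferred_of_mem (ht : t ∈ R) : Inferred R t := by
  have hU : {x | x ∈ t.pair} ∪ {t.out} = t.leaves := by
    ext x
    exact Iff.rfl
  refine ⟨{x | x ∈ t.pair}, {t.out}, hU ▸ leaves_subset_of_mem ht, ?_, fun x hx => hx, rfl⟩
  rw [Split, hU]
  refine ⟨fun x hx y hy => ?_, ?_⟩
  · by_cases hxy : x = y
    · exact hxy ▸ (linked_equivalence _ _).refl _
    · exact linked_pair ht subset_rfl ((Sym2.mem_and_mem_iff hxy).1 ⟨hx, hy⟩)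
  · rintro x rfl y rfl
    exact (linked_equivalence _ _).refl _

/-- The union of all pair sides of the two-component Aho graphs crossed by `t`. -/
def side (R : Set (Triple α)) (t : Triple α) : Set α :=
  {x | ∃ A C, A ∪ C ⊆ leaves R ∧ Split R A C ∧ Crosses t A C ∧ x ∈ A}

/-- The union of all outer sides of the two-component Aho graphs crossed by `t`. -/
def coside (R : Set (Triple α)) (t : Triple α) : Set α :=
  {x | ∃ A C, A ∪ C ⊆ leaves R ∧ Split R A C ∧ Crosses t A C ∧ x ∈ C}

/-- The vertex set of the largest two-component Aho graph crossed by `t`. -/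
def scope (R : Set (Triple α)) (t : Triple α) : Set α :=
  side R t ∪ coside R t

lemma scope_subset_leaves (R : Set (Triple α)) (t : Triple α) : scope R t ⊆ leaves R := by
  rintro x (⟨A, C, h, -, -, hx⟩ | ⟨A, C, h, -, -, hx⟩)
  exacts [h (Or.inl hx), h (Or.inr hx)]

lemma subset_side (h : A ∪ C ⊆ leaves R) (hs : Split R A C) (ht : Crosses t A C) :
    A ⊆ side R t ∧ C ⊆ coside R t :=
  ⟨fun _ hx => ⟨A, C, h, hs, ht, hx⟩, fun _ hx => ⟨A, C, h, hs, ht, hx⟩⟩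

lemma subset_scope (h : A ∪ C ⊆ leaves R) (hs : Split R A C) (ht : Crosses t A C) :
    A ∪ C ⊆ scope R t :=
  Set.union_subset_union (subset_side h hs ht).1 (subset_side h hs ht).2

lemma crosses_side (ht : Inferred R t) : Crosses t (side R t) (coside R t) := by
  obtain ⟨A, C, h, hs, hc⟩ := ht
  exact ⟨fun x hx => (subset_side h hs hc).1 (hc.1 x hx), (subset_side h hs hc).2 hc.2⟩

lemma leaves_subset_scope (ht : Inferred R t) : t.leaves ⊆ scope R t :=
  Triple.leaves_subset_iff.2
    ⟨fun x hx => Or.inl ((crosses_side ht).1 x hx), Or.inr (crosses_side ht).2⟩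

/-- All pair sides share the pair of `t` and all outer sides share `t.out`, so the unions remain
connected. -/
lemma split_side (R : Set (Triple α)) (t : Triple α) : Split R (side R t) (coside R t) := by
  obtain ⟨p, hp⟩ : ∃ p, p ∈ t.pair := ⟨_, Sym2.out_fst_mem t.pair⟩
  constructor
  · have key : ∀ x ∈ side R t, Linked R (side R t ∪ coside R t) x p := by
      rintro x ⟨A, C, h, hs, hc, hx⟩
      exact (hs.1 x hx p (hc.1 p hp)).mono subset_rfl (subset_scope h hs hc)
    exact fun x hx y hy => (key x hx).trans (key y hy).symm
  · have key : ∀ x ∈ coside R t, Linked R (side R t ∪ coside R t) x t.out := by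
      rintro x ⟨A, C, h, hs, hc, hx⟩
      exact (hs.2 x hx _ hc.2).mono subset_rfl (subset_scope h hs hc)
    exact fun x hx y hy => (key x hx).trans (key y hy).symm

lemma AhoConsistent.not_linked_of_split (hR : AhoConsistent R) (hAC : A ∪ C ⊆ leaves R)
    (hs : Split R A C) {a c : α} (ha : a ∈ A) (hc : c ∈ C) (hac : a ≠ c) :
    ¬ Linked R (A ∪ C) a c := by
  intro h
  obtain ⟨x, hx, y, hy, hxy⟩ := hR.2 _ hAC ⟨a, Or.inl ha, c, Or.inr hc, hac⟩
  have all : ∀ x ∈ A ∪ C, Linked R (A ∪ C) x c := by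
    rintro x (hx | hx)
    exacts [(hs.1 x hx a ha).trans h, hs.2 x hx c hc]
  exact hxy ((all x hx).trans (all y hy).symm)

lemma AhoConsistent.disjoint_side (hR : AhoConsistent R) (ht : t ∈ R) :
    ∀ x ∈ side R t, ∀ y ∈ coside R t, ¬ Linked R (scope R t) x y := by
  intro x hx y hy h
  obtain ⟨a, b, hab, -, hao, -⟩ := t.exists_pair_eq
  have hc := crosses_side (inferred_of_mem ht)
  have ha := hc.1 a (by simp [hab])
  exact hR.not_linked_of_split (scope_subset_leaves R t) (split_side R t) ha hc.2 hao
    ((((split_side R t).1 a ha x hx).trans h).trans ((split_side R t).2 y hy _ hc.2))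

/-- If `s` crosses the largest split of `t`, that split lies in the largest split of `s`, which `t`
therefore crosses too; maximality then applies both ways. The scope does not record which side is
which, so `s` may cross in the opposite direction. -/
lemma scope_eq_of_crosses (ht : t ∈ R)
    (hs : Crosses s (side R t) (coside R t) ∨ Crosses s (coside R t) (side R t)) :
    scope R s = scope R t := by
  have hct := crosses_side (inferred_of_mem ht)
  have hl := scope_subset_leaves R s
  rcases hs with hs | hs
  · obtain ⟨h₁, h₂⟩ := subset_side (scope_subset_leaves R t) (split_side R t) hs
    exact (subset_scope hl (split_side R s) ⟨fun x hx => h₁ (hct.1 x hx), h₂ hct.2⟩).antisymm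
      (Set.union_subset_union h₁ h₂)
  · have hlt := scope_subset_leaves R t
    rw [scope, Set.union_comm] at hl hlt
    obtain ⟨h₁, h₂⟩ := subset_side hlt (split_side R t).symm hs
    have := subset_scope hl (split_side R s).symm ⟨fun x hx => h₂ (hct.1 x hx), h₁ hct.2⟩
    rw [Set.union_comm] at this
    exact this.antisymm (Set.union_subset (h₂.trans Set.subset_union_right)
      (h₁.trans Set.subset_union_left))

/-- The triples of `R` inside the scope of `t` have the same scope or a smaller one. -/
lemma AhoConsistent.scope_eq_or_ssubset (hR : AhoConsistent R) (ht : t ∈ R) (hs : s ∈ R)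
    (hst : s.leaves ⊆ scope R t) : scope R s = scope R t ∨ scope R s ⊂ scope R t := by
  obtain ⟨a, b, hab, -⟩ := s.exists_pair_eq
  have hlink : Linked R (scope R t) a b := linked_pair hs hst hab
  have hdis := hR.disjoint_side ht
  have hct := crosses_side (inferred_of_mem ht)
  obtain ⟨p, hp⟩ : ∃ p, p ∈ t.pair := ⟨_, Sym2.out_fst_mem t.pair⟩
  have hpt := hct.1 p hp
  have hlt := scope_subset_leaves R t
  have hls := scope_subset_leaves R s
  obtain ⟨hps, hos⟩ := Triple.leaves_subset_iff.1 hst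
  have hcs := crosses_side (inferred_of_mem hs)
  -- If a connected side `D` contains all leaves of `s`, it joins the two sides of the split of `s`,
  -- so the whole scope of `s` can be merged into `D`.
  have hscope : ∀ {D : Set α}, D ⊆ scope R t →
      (∀ x ∈ D, ∀ y ∈ D, Linked R (scope R t) x y) → s.leaves ⊆ D →
      ∀ x ∈ D ∪ scope R s, ∀ y ∈ D ∪ scope R s, Linked R (scope R t ∪ scope R s) x y := by
    intro D hD hlD hsD
    obtain ⟨hpD, hoD⟩ := Triple.leaves_subset_iff.1 hsD
    have hpo : Linked R (scope R t ∪ scope R s) a s.out :=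
      (hlD a (hpD a (by simp [hab])) _ hoD).mono subset_rfl Set.subset_union_left
    have key : ∀ x ∈ D ∪ scope R s, Linked R (scope R t ∪ scope R s) x s.out := by
      rintro x (hx | hx | hx)
      · exact (hlD x hx _ hoD).mono subset_rfl Set.subset_union_left
      · exact (((split_side R s).1 x hx a (hcs.1 a (by simp [hab]))).mono subset_rfl
          Set.subset_union_right).trans hpo
      · exact ((split_side R s).2 x hx _ hcs.2).mono subset_rfl Set.subset_union_right
    exact fun x hx y hy => (key x hx).trans (key y hy).symm
  by_cases ha : a ∈ side R t
  · have hb : b ∈ side R t :=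
      (hps b (by simp [hab])).resolve_right fun hb => hdis a ha b hb hlink
    have hpair : ∀ x ∈ s.pair, x ∈ side R t := by simp [hab, ha, hb]
    rcases hos with ho | ho
    · right
      have h := hscope Set.subset_union_left (split_side R t).1
        (Triple.leaves_subset_iff.2 ⟨hpair, ho⟩)
      have hU : (side R t ∪ scope R s) ∪ coside R t = scope R t ∪ scope R s := by
        rw [Set.union_right_comm]
        rfl
      have hsplit : Split R (side R t ∪ scope R s) (coside R t) := by
        rw [Split, hU]
        exact ⟨h, fun x hx y hy =>
          ((split_side R t).2 x hx y hy).mono subset_rfl Set.subset_union_left⟩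
      -- The enlarged split is still crossed by `t`, so by maximality the scope of `s` already lies
      -- in one side; the other side is nonempty and disjoint from it, so the inclusion is strict.
      have hsub := (subset_side (t := t) (hU ▸ Set.union_subset hlt hls) hsplit
        ⟨fun x hx => Or.inl (hct.1 x hx), hct.2⟩).1
      refine ⟨fun x hx => Or.inl (hsub (Or.inr hx)), fun hsup => ?_⟩
      exact hdis _ (hsub (Or.inr (hsup (Or.inr hct.2)))) _ hct.2 ((linked_equivalence _ _).refl _)
    · exact Or.inl (scope_eq_of_crosses ht (Or.inl ⟨hpair, ho⟩))
  · have ha' : a ∈ coside R t := (hps a (by simp [hab])).resolve_left ha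
    have hb : b ∈ coside R t :=
      (hps b (by simp [hab])).resolve_left fun hb => hdis b hb a ha' hlink.symm
    have hpair : ∀ x ∈ s.pair, x ∈ coside R t := by simp [hab, ha', hb]
    rcases hos with ho | ho
    · exact Or.inl (scope_eq_of_crosses ht (Or.inr ⟨hpair, ho⟩))
    · right
      have h := hscope Set.subset_union_right (split_side R t).2
        (Triple.leaves_subset_iff.2 ⟨hpair, ho⟩)
      have hU : side R t ∪ (coside R t ∪ scope R s) = scope R t ∪ scope R s := by
        rw [← Set.union_assoc]
        rfl
      have hsplit : Split R (side R t) (coside R t ∪ scope R s) := by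
        rw [Split, hU]
        exact ⟨fun x hx y hy =>
          ((split_side R t).1 x hx y hy).mono subset_rfl Set.subset_union_left, h⟩
      have hsub := (subset_side (t := t) (hU ▸ Set.union_subset hlt hls) hsplit
        ⟨hct.1, Or.inl hct.2⟩).2
      refine ⟨fun x hx => Or.inr (hsub (Or.inr hx)), fun hsup => ?_⟩
      exact hdis _ hpt _ (hsub (Or.inr (hsup (Or.inl hpt)))) ((linked_equivalence _ _).refl _)

/-! ### Ties: a graphic matroid for each scope -/

/-- The pair of a triple of `R` with a smaller scope than `t`, or of a triple of `S` with the same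
scope as `t`. -/
def Tie (R S : Set (Triple α)) (t : Triple α) (x y : α) : Prop :=
  ∃ s, s.pair = s(x, y) ∧ (s ∈ R ∧ scope R s ⊂ scope R t ∨ s ∈ S ∧ scope R s = scope R t)

/-- The triples of `R` whose pair is connected by ties. -/
def tieClosure (R S : Set (Triple α)) : Set (Triple α) :=
  {t ∈ R | ∀ x y, t.pair = s(x, y) → Relation.EqvGen (Tie R S t) x y}

/-- A split for `S` crossed by `t` lies inside `scope R t`, so each edge of its Aho graph is a tie.
-/
lemma AhoConsistent.subset_tieClosure (hR : AhoConsistent R) (hSR : S ⊆ R)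
    (h : ∀ t ∈ R, Inferred S t) : R ⊆ tieClosure R S := by
  refine fun t ht => ⟨ht, fun x y hxy => ?_⟩
  obtain ⟨A, C, hAC, hs, hc⟩ := h t ht
  have hsub := subset_scope (hAC.trans (leaves_mono hSR)) (hs.mono hSR) hc
  refine eqvGen_imp (Relation.EqvGen.is_equivalence _) ?_
    (hs.1 x (hc.1 x (by simp [hxy])) y (hc.1 y (by simp [hxy])))
  rintro u v ⟨s, hsS, hsL, huv⟩
  refine .rel _ _ ⟨s, huv, ?_⟩
  rcases hR.scope_eq_or_ssubset ht (hSR hsS) (hsL.trans hsub) with h | h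
  exacts [Or.inr ⟨hsS, h⟩, Or.inl ⟨hSR hsS, h⟩]

lemma eq_of_linked_of_notMem_leaves {L : Set α} {x y : α} (h : Linked S L x y)
    (hx : x ∉ leaves S) : x = y := by
  have := eqvGen_imp (s := fun x y => x = y ∨ x ∈ leaves S ∧ y ∈ leaves S)
    ⟨fun _ => Or.inl rfl, ?_, ?_⟩ (fun _ _ h => Or.inr h.mem_leaves) h
  · exact this.resolve_right fun h => hx h.1
  · rintro x y (rfl | h)
    exacts [Or.inl rfl, Or.inr h.symm]
  · rintro x y z (rfl | h) (rfl | h')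
    exacts [Or.inl rfl, Or.inr h', Or.inr h, Or.inr ⟨h.1, h'.2⟩]

/-- A vertex of `C` outside `leaves S` would be isolated, hence all of `C`. Then no triple of `S`
inside `A ∪ C` uses `C`, and `[R, A]` would be connected. -/
lemma AhoConsistent.union_subset_leaves (hR : AhoConsistent R) (hSR : S ⊆ R)
    (hAC : A ∪ C ⊆ leaves R) (hA : A.Nontrivial) (hs : Split S A C) : A ∪ C ⊆ leaves S := by
  have hAS : A ⊆ leaves S := by
    intro x hx
    obtain ⟨y, hy, hyx⟩ := hA.exists_ne x
    by_contra h
    exact hyx (eq_of_linked_of_notMem_leaves (hs.1 x hx y hy) h).symm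
  refine Set.union_subset hAS fun z hz => ?_
  by_contra hzS
  have hC : ∀ y ∈ C, y = z := fun y hy => (eq_of_linked_of_notMem_leaves (hs.2 z hz y hy) hzS).symm
  obtain ⟨x, hx, y, hy, hxy⟩ := hR.2 A (Set.subset_union_left.trans hAC) hA
  refine hxy (eqvGen_imp (linked_equivalence R A) ?_ (hs.1 x hx y hy))
  rintro u v ⟨s, hsS, hsL, huv⟩
  refine linked_pair (hSR hsS) (fun w hw => (hsL hw).resolve_right fun hwC => hzS ?_) huv
  exact hC w hwC ▸ leaves_subset_of_mem hsS hw

lemma AhoConsistent.inferred_of_subset_tieClosure (hR : AhoConsistent R) (hSR : S ⊆ R)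
    (h : R ⊆ tieClosure R S) : ∀ t ∈ R, Inferred S t := by
  -- By induction on the size of the scope, `S` alone connects every pair inside its scope; then the
  -- largest split for `R` is also a split for `S`.
  suffices hlink : ∀ n, ∀ t ∈ R, (scope R t).ncard = n → ∀ x y, t.pair = s(x, y) →
      Linked S (scope R t) x y by
    intro t ht
    have hc := crosses_side (inferred_of_mem ht)
    have key : ∀ x y, Linked R (scope R t) x y → Linked S (scope R t) x y := by
      refine fun x y => eqvGen_imp (linked_equivalence _ _) ?_
      rintro u v ⟨s, hs, hsL, huv⟩
      refine (hlink _ s hs rfl u v huv).mono subset_rfl ?_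
      rcases hR.scope_eq_or_ssubset ht hs hsL with h | h
      exacts [h.le, h.1]
    have hs : Split S (side R t) (coside R t) :=
      ⟨fun x hx y hy => key x y ((split_side R t).1 x hx y hy),
        fun x hx y hy => key x y ((split_side R t).2 x hx y hy)⟩
    obtain ⟨a, b, hab, hne, -⟩ := t.exists_pair_eq
    exact ⟨_, _, hR.union_subset_leaves hSR (scope_subset_leaves R t)
      ⟨a, hc.1 a (by simp [hab]), b, hc.1 b (by simp [hab]), hne⟩ hs, hs, hc⟩
  intro n
  induction n using Nat.strong_induction_on with
  | _ n ih =>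
    intro t ht hn x y hxy
    refine eqvGen_imp (linked_equivalence _ _) ?_ ((h ht).2 x y hxy)
    rintro u v ⟨s, huv, ⟨hsR, hst⟩ | ⟨hsS, hst⟩⟩
    · have hlt := Set.ncard_lt_ncard hst (hR.1.subset (scope_subset_leaves R t))
      exact (ih _ (hn ▸ hlt) s hsR rfl u v huv).mono subset_rfl hst.1
    · exact linked_pair hsS (hst ▸ leaves_subset_scope (inferred_of_mem (hSR hsS))) huv

theorem AhoConsistent.mem_sc_iff_subset_tieClosure (hR : AhoConsistent R) :
    S ∈ sc R ↔ S ⊆ R ∧ R ⊆ tieClosure R S :=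
  hR.mem_sc_iff.trans <| and_congr_right fun hSR =>
    ⟨hR.subset_tieClosure hSR, hR.inferred_of_subset_tieClosure hSR⟩

lemma tieClosure_mono {S' : Set (Triple α)} (h : S ⊆ S') : tieClosure R S ⊆ tieClosure R S' := by
  refine fun t ht => ⟨ht.1, fun x y hxy => (ht.2 x y hxy).mono ?_⟩
  rintro u v ⟨s, huv, hs | hs⟩
  exacts [⟨s, huv, Or.inl hs⟩, ⟨s, huv, Or.inr ⟨h hs.1, hs.2⟩⟩]

lemma subset_tieClosure_self (hSR : S ⊆ R) : S ⊆ tieClosure R S :=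
  fun t ht => ⟨hSR ht, fun _ _ hxy => .rel _ _ ⟨t, hxy, Or.inr ⟨ht, rfl⟩⟩⟩

/-- Ties depend on `t` only through its scope, so a tie through a triple of the closure can be
replaced by a chain of ties of `S`. -/
lemma tieClosure_tieClosure : tieClosure R (tieClosure R S) ⊆ tieClosure R S := by
  refine fun t ht => ⟨ht.1, fun x y hxy =>
    eqvGen_imp (Relation.EqvGen.is_equivalence _) ?_ (ht.2 x y hxy)⟩
  rintro u v ⟨s, huv, hs | ⟨hs, hst⟩⟩
  · exact .rel _ _ ⟨s, huv, Or.inl hs⟩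
  · have htie : Tie R S s = Tie R S t := by
      funext x y
      rw [Tie, Tie, hst]
    exact htie ▸ hs.2 u v huv

lemma tieClosure_exchange (hs : s ∈ R) (ht : t ∈ tieClosure R (insert s S))
    (ht' : t ∉ tieClosure R S) : s ∈ tieClosure R (insert t S) := by
  obtain ⟨p, q, hpq, -⟩ := s.exists_pair_eq
  obtain ⟨u, v, huv, -⟩ := t.exists_pair_eq
  have hn : ¬ Relation.EqvGen (Tie R S t) u v := by
    refine fun h => ht' ⟨ht.1, fun x y hxy => ?_⟩
    rcases Sym2.eq_iff.1 (huv.symm.trans hxy) with ⟨rfl, rfl⟩ | ⟨rfl, rfl⟩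
    exacts [h, h.symm]
  -- A triple `s` of another scope would add no tie for `t`. Within one scope this is the exchange
  -- of edges: if adding `pq` connects `u` to `v`, then adding `uv` connects `p` to `q`.
  have hst : scope R s = scope R t := by
    by_contra hst
    refine hn ((ht.2 u v huv).mono ?_)
    rintro x y ⟨r, hxy, h | ⟨rfl | h, h'⟩⟩
    exacts [⟨r, hxy, Or.inl h⟩, absurd h' hst, ⟨r, hxy, Or.inr ⟨h, h'⟩⟩]
  have h := eqvGen_or_of_single (r := Tie R S t) (p := p) (q := q) ?_ (ht.2 u v huv)
  · have hmono : ∀ {x y}, Relation.EqvGen (Tie R S t) x y →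
        Relation.EqvGen (Tie R (insert t S) s) x y := by
      intro x y hxy
      refine hxy.mono ?_
      rintro x y ⟨r, hxy, h | ⟨h, h'⟩⟩
      exacts [⟨r, hxy, Or.inl ⟨h.1, hst ▸ h.2⟩⟩,
        ⟨r, hxy, Or.inr ⟨Or.inr h, h'.trans hst.symm⟩⟩]
    have huv' : Relation.EqvGen (Tie R (insert t S) s) u v :=
      .rel _ _ ⟨t, huv, Or.inr ⟨Or.inl rfl, hst.symm⟩⟩
    have key : Relation.EqvGen (Tie R (insert t S) s) p q := by
      rcases h.resolve_left hn with ⟨h₁ | h₁, h₂ | h₂⟩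
      · exact absurd (h₁.trans _ _ _ h₂.symm) hn
      · exact ((hmono h₁).symm.trans _ _ _ huv').trans _ _ _ (hmono h₂)
      · exact (((hmono h₂).symm.trans _ _ _ huv'.symm).trans _ _ _ (hmono h₁))
      · exact absurd (h₁.trans _ _ _ h₂.symm) hn
    refine ⟨hs, fun x y hxy => ?_⟩
    rcases Sym2.eq_iff.1 (hpq.symm.trans hxy) with ⟨rfl, rfl⟩ | ⟨rfl, rfl⟩
    exacts [key, key.symm]
  · rintro x y ⟨r, hxy, h | ⟨rfl | h, h'⟩⟩
    exacts [Or.inl ⟨r, hxy, Or.inl h⟩, Or.inr (hxy.symm.trans hpq), Or.inl ⟨r, hxy, Or.inr ⟨h, h'⟩⟩]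

lemma AhoConsistent.finite (hR : AhoConsistent R) : R.Finite := by
  have hinj : Function.Injective fun t : Triple α => (t.pair, t.out) :=
    fun s t h => Triple.ext (Prod.ext_iff.1 h).1 (Prod.ext_iff.1 h).2
  have hfin := ((hR.1.prod hR.1).image fun x => s(x.1, x.2)).prod hR.1
  refine (hfin.preimage hinj.injOn).subset fun t ht => ?_
  obtain ⟨a, b, hab, -⟩ := t.exists_pair_eq
  have hmem : ∀ x ∈ t.leaves, x ∈ leaves R := fun x hx => leaves_subset_of_mem ht hx
  exact ⟨⟨(a, b), ⟨hmem a (Or.inl (by simp [hab])), hmem b (Or.inl (by simp [hab]))⟩, hab.symm⟩,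
    hmem _ (Or.inr rfl)⟩

end TripleSet

/-! ### From a closure operator to a matroid -/

/-- The minimal spanning sets of a closure operator with the exchange property on a finite set are
the bases of a matroid. -/
theorem Matroid.exists_isBase_iff_minimal_spanning {β : Type*} {E : Set β} (hE : E.Finite)
    (φ : Set β → Set β) (mono : ∀ ⦃X Y⦄, X ⊆ Y → φ X ⊆ φ Y) (ext : ∀ ⦃X⦄, X ⊆ E → X ⊆ φ X)
    (idem : ∀ X, φ (φ X) ⊆ φ X)
    (exch : ∀ X, ∀ x ∈ E, ∀ y, y ∈ φ (insert x X) → y ∉ φ X → x ∈ φ (insert y X)) :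
    ∃ M : Matroid β, M.E = E ∧ ∀ B, M.IsBase B ↔ Minimal (fun X => X ⊆ E ∧ E ⊆ φ X) B := by
  have spans : ∀ {X Y}, E ⊆ φ Y → Y ⊆ φ X → E ⊆ φ X := fun h h' => h.trans ((mono h').trans (idem _))
  have red : ∀ {B}, Minimal (fun X => X ⊆ E ∧ E ⊆ φ X) B → ∀ x ∈ B, x ∉ φ (B \ {x}) := by
    intro B hB x hx hxφ
    suffices h : B ⊆ φ (B \ {x}) by
      have hsub : B ⊆ B \ {x} :=
        hB.2 ⟨Set.sdiff_subset.trans hB.1.1, spans hB.1.2 h⟩ Set.sdiff_subset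
      exact (hsub hx).2 rfl
    intro y hy
    by_cases hyx : y = x
    · exact hyx ▸ hxφ
    · exact ext (Set.sdiff_subset.trans hB.1.1) ⟨hy, hyx⟩
  refine ⟨Matroid.ofIsBaseOfFinite hE (Minimal fun X => X ⊆ E ∧ E ⊆ φ X) ?_ ?_ fun B hB => hB.1.1,
    rfl, fun B => Iff.rfl⟩
  · obtain ⟨B, -, hB⟩ := (hE.finite_subsets.subset
      (fun X (hX : X ⊆ E ∧ E ⊆ φ X) => hX.1)).exists_le_minimal
      (show E ∈ {X | X ⊆ E ∧ E ⊆ φ X} from ⟨subset_rfl, ext subset_rfl⟩)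
    exact ⟨B, hB⟩
  · intro B B' hB hB' x hx
    have hBE : B \ {x} ⊆ E := Set.sdiff_subset.trans hB.1.1
    -- If `φ (B \ {x})` contained `B'`, it would contain `E` and hence `x`, contrary to the
    -- irredundancy of `B`.
    obtain ⟨y, hyB', hy⟩ : ∃ y ∈ B', y ∉ φ (B \ {x}) := by
      by_contra! h
      exact red hB x hx.1 (spans hB'.1.2 h (hB.1.1 hx.1))
    have hyE := hB'.1.1 hyB'
    have hyBx : y ∉ B \ {x} := fun h => hy (ext hBE h)
    have hyx : y ≠ x := fun h => hx.2 (h ▸ hyB')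
    have hyB : y ∉ B := fun h => hyBx ⟨h, hyx⟩
    have hins : insert x (B \ {x}) = B := Set.insert_sdiff_self_of_mem hx.1
    have hNE : insert y (B \ {x}) ⊆ E := Set.insert_subset hyE hBE
    refine ⟨y, ⟨hyB', hyB⟩, ⟨hNE, ?_⟩, fun Z hZ hZN z hz => ?_⟩
    · refine spans hB.1.2 fun w hw => ?_
      by_cases hwx : w = x
      · subst hwx
        exact exch _ w (hB.1.1 hw) y (by rw [hins]; exact hB.1.2 hyE) hy
      · exact ext hNE (Or.inr ⟨hw, hwx⟩)
    -- Minimality: were `z` superfluous, then `y ∈ φ (B \ {x})` would follow, by monotonicity if `z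
    -- = y` and by exchanging `z` for `y` over `B \ {x, z}` otherwise.
    · by_contra hzZ
      rcases hz with rfl | hz
      · exact hy (mono (fun w hw => (hZN hw).resolve_left fun h => hzZ (h ▸ hw)) (hZ.2 hyE))
      · have hzy : z ≠ y := fun h => hyBx (h ▸ hz)
        have hzφ : z ∉ φ ((B \ {x}) \ {z}) := fun h =>
          red hB z hz.1 (mono (Set.sdiff_subset_sdiff_left Set.sdiff_subset) h)
        have hzN : z ∈ φ (insert y ((B \ {x}) \ {z})) := by
          refine mono (fun w hw => ?_) (hZ.2 (hBE hz))
          rcases hZN hw with rfl | h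
          · exact Or.inl rfl
          · exact Or.inr ⟨h, fun h' => hzZ (h' ▸ hw)⟩
        have := exch _ y hyE z hzN hzφ
        rw [Set.insert_sdiff_self_of_mem hz] at this
        exact hy this

theorem mainTheorem2 {α : Type*} (R : Set (Triple α)) (hR : TripleSet.Consistent R) :
    (∃ M : Matroid (Triple α), M.E = R ∧
      (∀ I, M.Indep I ↔ I ∈ TripleSet.indepSets R) ∧
      (∀ B, M.IsBase B ↔ B ∈ TripleSet.minSc R)) ∧
    TripleSet.minSc R = TripleSet.MINSc R := by
  have hR' := hR.ahoConsistent
  obtain ⟨M, hME, hM⟩ := Matroid.exists_isBase_iff_minimal_spanning hR'.finite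
    (TripleSet.tieClosure R) (fun _ _ => TripleSet.tieClosure_mono)
    (fun _ => TripleSet.subset_tieClosure_self) (fun _ => TripleSet.tieClosure_tieClosure)
    (fun _ _ hx _ => TripleSet.tieClosure_exchange hx)
  have hbase : ∀ B, M.IsBase B ↔ B ∈ TripleSet.minSc R := by
    intro B
    simp only [hM, ← hR'.mem_sc_iff_subset_tieClosure]
    exact ⟨fun h => ⟨h.1, fun X hX hXB => hXB.antisymm (h.2 hX hXB)⟩,
      fun h => ⟨h.1, fun X hX hXB => (h.2 X hX hXB).ge⟩⟩
  refine ⟨⟨M, hME, fun I => ?_, hbase⟩, ?_⟩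
  · simp only [Matroid.indep_iff, hbase]
    rfl
  · ext B
    constructor
    · refine fun hB => ⟨hB.1, fun X hX => ?_⟩
      -- Every representative set contains a minimal one, which is a base and so has the cardinality
      -- of `B`.
      obtain ⟨Y, hYX, hY⟩ := (hR'.finite.finite_subsets.subset
        (fun X (hX : X ∈ TripleSet.sc R) => hX.1)).exists_le_minimal hX
      have hY' : Y ∈ TripleSet.minSc R :=
        ⟨hY.1, fun Z hZ hZY => hZY.antisymm (hY.2 hZ hZY)⟩
      rw [((hbase B).2 hB).encard_eq_encard_of_isBase ((hbase Y).2 hY')]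
      exact Set.encard_le_encard hYX
    · refine fun hB => ⟨hB.1, fun X hX hXB => ?_⟩
      exact (hR'.finite.subset hX.1).eq_of_subset_of_encard_le hXB (hB.2 X hX)
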